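/- A \emph{Heyting category} is a regular category in which every poset of subobjects $\mathrm{Sub}(X)$ is a Heyting algebra and every inverse image map $f^{-1}:\mathrm{Sub}(Y)\to\mathrm{Sub}(X)$ has both a left adjoint $\exists_f$ and a right adjoint $\forall_f$. Let $\mathcal E$ be a Heyting category; the following definitions are read in its internal language. An object is \emph{inhabited} if its map to the terminal object is a regular epimorphism, and two subobjects \emph{intersect} if their intersection is inhabited. An \emph{ordered partial applicative structure} is an object $A$ with a partial order $\le$ and a monotone partial binary operation $(a,b)\mapsto ab$ with downward closed domain. The \emph{partial combinatory arrows} $A^n\rightharpoonup A$ are those generated from the projections by pointwise application. The \emph{object of realizers} of a partial combinatory arrow $f:A^n\rightharpoonup A$ is the subobject of those $a\in A$ such that $((ax_1)\cdots)x_{n-1}$ is defined for all $x_1,\dots,x_{n-1}\in A$ and such that for all $\vec x\in\mathrm{dom} f$, $((ax_1)\cdots)x_n$ is defined and $\le f(\vec x)$. An \emph{OPCA pair} $(A',A)$ consists of an ordered partial applicative structure $A$ and a subobject $A'$ of $A$ that is closed under application (if $x,y\in A'$ and $xy$ is defined, then $xy\in A'$) and that intersects the object of realizers of every partial combinatory arrow.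 An \emph{assembly} is a pair $(X,Y)$ of an object $X$ of $\mathcal E$ and a subobject $Y\subseteq A\times X$ such that for all $x\in X$ there is an $a\in A$ with $(a,x)\in Y$, and such that $(a,x)\in Y$ and $b\le a$ imply $(b,x)\in Y$. A \emph{morphism} $(X,Y)\to(X',Y')$ is an arrow $f:X\to X'$ for which there is a subobject $V\subseteq A$ that intersects $A'$ and tracks $f$: for all $a\in V$ and $(b,x)\in Y$, $ab$ is defined and $(ab,f(x))\in Y'$. This gives the category $\mathsf{Asm}(A',A)$, with the forgetful functor $\mathrm D:\mathsf{Asm}(A',A)\to\mathcal E$, $\mathrm D(X,Y)=X$, and the functor $\nabla:\mathcal E\to\mathsf{Asm}(A',A)$, $\nabla X=(X,A\times X)$, $\nabla f=f$. \textbf{Lemma.} For every Heyting category $\mathcal E$ and every OPCA pair $(A',A)$ in $\mathcal E$, the category $\mathsf{Asm}(A',A)$ is a Heyting category. The functor $\mathrm D$ is regular (it preserves finite limits and regular epimorphisms) and faithful, and $\nabla$ is a regular functor and a right adjoint of $\mathrm D$. -/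

import Mathlib

open CategoryTheory CategoryTheory.Limits

universe v u

noncomputable section

namespace RelRealizability

/-- A Heyting category: a regular category in which every poset of subobjects is a Heyting algebra
and in which every inverse image map has both a left and a right adjoint.
(A top element and binary meets of subobjects exist because of the finite limits, see the instances
`Subobject.orderTop` and `Subobject.semilatticeInf`.) -/
class HeytingCategory (C : Type u) [Category.{v} C] : Prop extends Regular C where
  exists_bot : ∀ X : C, ∃ B : Subobject X, ∀ U : Subobject X, B ≤ U
  exists_sup : ∀ {X : C} (U V : Subobject X), ∃ W : Subobject X, IsLUB {U, V} W
  exists_himp : ∀ {X : C} (U V : Subobject X), ∃ W : Subobject X,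
    ∀ T : Subobject X, T ≤ W ↔ T ⊓ U ≤ V
  exists_leftAdjoint : ∀ {X Y : C} (f : X ⟶ Y), ∃ l : Subobject X → Subobject Y,
    GaloisConnection l (Subobject.pullback f).obj
  exists_rightAdjoint : ∀ {X Y : C} (f : X ⟶ Y), ∃ r : Subobject X → Subobject Y,
    GaloisConnection (Subobject.pullback f).obj r

/-- A regular functor preserves finite limits and regular epimorphisms. -/
structure IsRegularFunctor {C D : Type*} [Category C] [Category D] (F : C ⥤ D) : Prop where
  preservesFiniteLimits : PreservesFiniteLimits F
  map_regularEpi : ∀ {X Y : C} (f : X ⟶ Y), IsRegularEpi f → IsRegularEpi (F.map f)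

section Basics

variable {E : Type u} [Category.{v} E] [HasFiniteLimits E]

/-- An object is inhabited if its map to the terminal object is a regular epimorphism
(the validity of `∃ x, ⊤` in the internal language). -/
def IsInhabited (X : E) : Prop := IsRegularEpi (terminal.from X)

/-- Two subobjects intersect if their intersection is inhabited. -/
def Intersects {X : E} (U V : Subobject X) : Prop := IsInhabited ((U ⊓ V : Subobject X) : E)

variable (E) in
/-- An ordered partial applicative structure in `E`: an object with an internal partial order and
an internal partial binary operation, whose domain is downward closed and which is monotone.
Internal statements are spelled out for generalized elements `a : T ⟶ carrier`. -/
structure OPAS where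
  carrier : E
  /-- the order relation `{(a, b) | a ≤ b}` -/
  leq : Subobject (carrier ⨯ carrier)
  /-- the domain `{(a, b) | ab↓}` of the application -/
  dom : Subobject (carrier ⨯ carrier)
  /-- the application `(a, b) ↦ ab` -/
  app : (dom : E) ⟶ carrier
  le_refl : ∀ {T : E} (a : T ⟶ carrier), leq.Factors (prod.lift a a)
  le_trans : ∀ {T : E} (a b c : T ⟶ carrier), leq.Factors (prod.lift a b) →
    leq.Factors (prod.lift b c) → leq.Factors (prod.lift a c)
  le_antisymm : ∀ {T : E} (a b : T ⟶ carrier), leq.Factors (prod.lift a b) →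
    leq.Factors (prod.lift b a) → a = b
  app_mono : ∀ {T : E} (a b a' b' : T ⟶ carrier), leq.Factors (prod.lift a a') →
    leq.Factors (prod.lift b b') → ∀ h' : dom.Factors (prod.lift a' b'),
      ∃ h : dom.Factors (prod.lift a b), leq.Factors
        (prod.lift (dom.factorThru _ h ≫ app) (dom.factorThru _ h' ≫ app))

/-- Applicative terms in `n` variables. They denote the partial combinatory arrows of arity `n`:
the partial arrows `Aⁿ ⇀ A` generated from the projections by pointwise application. -/
inductive CombTerm (n : ℕ) : Type
  | var (i : Fin n) : CombTerm n
  | app (s t : CombTerm n) : CombTerm n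

namespace OPAS

variable (A : OPAS E)

/-- The order on generalized elements. -/
def Le {T : E} (a b : T ⟶ A.carrier) : Prop := A.leq.Factors (prod.lift a b)

/-- Application of generalized elements; it is defined if the pair factors through the domain. -/
def ap {T : E} (a b : T ⟶ A.carrier) : Part (T ⟶ A.carrier) :=
  ⟨A.dom.Factors (prod.lift a b), fun h => A.dom.factorThru _ h ≫ A.app⟩

/-- Iterated application `((a x₁) …) xₙ`. -/
def apList {T : E} (a : T ⟶ A.carrier) : List (T ⟶ A.carrier) → Part (T ⟶ A.carrier)
  | [] => Part.some a
  | x :: l => (A.ap a x).bind fun b => apList b l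

/-- The partial combinatory arrow denoted by a term, on generalized elements of `Aⁿ`. -/
def eval {T : E} {n : ℕ} (x : Fin n → (T ⟶ A.carrier)) : CombTerm n → Part (T ⟶ A.carrier)
  | .var i => Part.some (x i)
  | .app s t => (eval x s).bind fun a => (eval x t).bind fun b => A.ap a b

/-- `R` is the object of realizers of the partial combinatory arrow `f` denoted by `t`, that is
`R = {a | (∀ x₁ … xₙ₋₁, ((a x₁) …) xₙ₋₁ ↓) ∧
  ∀ x ∈ dom f, ∃ z, ((a x₁) …) xₙ ↓ z ∧ z ≤ f x}` in the internal language.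
This condition determines `R` uniquely. -/
def IsRealizerObject {n : ℕ} (t : CombTerm n) (R : Subobject A.carrier) : Prop :=
  ∀ {T : E} (a : T ⟶ A.carrier), R.Factors a ↔
    ∀ {S : E} (s : S ⟶ T) (x : Fin n → (S ⟶ A.carrier)),
      (A.apList (s ≫ a) (List.ofFn x).dropLast).Dom ∧
      ∀ y ∈ A.eval x t, ∃ z ∈ A.apList (s ≫ a) (List.ofFn x), A.Le z y

end OPAS

variable (E) in
/-- An OPCA pair `(A', A)`: an ordered partial applicative structure `A` with a subobject `A'` that
is closed under application and that intersects the object of realizers of every partial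
combinatory arrow of `A`. -/
structure OPCAPair extends OPAS E where
  /-- the subobject `A'` -/
  sub : Subobject carrier
  sub_closed : ∀ {T : E} (a b c : T ⟶ carrier), sub.Factors a → sub.Factors b →
    c ∈ toOPAS.ap a b → sub.Factors c
  combinatory : ∀ {n : ℕ} (t : CombTerm n), ∃ R : Subobject carrier,
    toOPAS.IsRealizerObject t R ∧ Intersects R sub

/-- An assembly `(X, Y)`. -/
structure Asm (P : OPCAPair E) where
  /-- the underlying object `X` -/
  obj : E
  /-- the realizability relation `Y = {(a, x) | a realizes x}` -/
  rel : Subobject (P.carrier ⨯ obj)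
  /-- every `x` has a realizer -/
  total : IsRegularEpi (rel.arrow ≫ prod.snd)
  down : ∀ {T : E} (a b : T ⟶ P.carrier) (x : T ⟶ obj), rel.Factors (prod.lift a x) →
    P.Le b a → rel.Factors (prod.lift b x)

/-- `V` tracks `f`: for all `a ∈ V` and `(b, x) ∈ Y`, `ab` is defined and `(ab, f x) ∈ Y'`. -/
def Tracks {P : OPCAPair E} {X X' : Asm P} (V : Subobject P.carrier) (f : X.obj ⟶ X'.obj) : Prop :=
  ∀ {T : E} (a b : T ⟶ P.carrier) (x : T ⟶ X.obj), V.Factors a → X.rel.Factors (prod.lift b x) →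
    ∃ c ∈ P.ap a b, X'.rel.Factors (prod.lift c (x ≫ f))

/-- A morphism of assemblies is an arrow that is tracked by some `V` that intersects `A'`. -/
@[ext]
structure Asm.Hom {P : OPCAPair E} (X X' : Asm P) where
  hom : X.obj ⟶ X'.obj
  tracked : ∃ V : Subobject P.carrier, Intersects V P.sub ∧ Tracks (X := X) (X' := X') V hom

end Basics

/-! ### Facts that are needed to define the category of assemblies -/

section Facts

variable {E : Type u} [Category.{v} E]

lemma factors_of_cover {T T' X : E} (e : T' ⟶ T) [StrongEpi e] (U : Subobject X) (x : T ⟶ X)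
    (h : U.Factors (e ≫ x)) : U.Factors x := by
  have sq : CommSq (U.factorThru _ h) e U.arrow x := ⟨by simp⟩
  have : sq.lift ≫ U.arrow = x := sq.fac_right
  rw [← this]
  exact Subobject.factors_comp_arrow _

variable [HasFiniteLimits E]

lemma OPAS.ap_comp (A : OPAS E) {T S : E} (s : S ⟶ T) {a b c : T ⟶ A.carrier}
    (h : c ∈ A.ap a b) : s ≫ c ∈ A.ap (s ≫ a) (s ≫ b) := by
  obtain ⟨h, rfl⟩ := h
  replace h : A.dom.Factors (prod.lift a b) := h
  have e : prod.lift (s ≫ a) (s ≫ b) = s ≫ prod.lift a b := by ext <;> simp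
  have h' : A.dom.Factors (prod.lift (s ≫ a) (s ≫ b)) :=
    e ▸ Subobject.factors_of_factors_right s h
  refine ⟨h', ?_⟩
  change A.dom.factorThru _ h' ≫ A.app = s ≫ A.dom.factorThru _ h ≫ A.app
  rw [← Category.assoc]
  congr 1
  rw [← cancel_mono A.dom.arrow, Category.assoc, Subobject.factorThru_arrow,
    Subobject.factorThru_arrow, e]

lemma OPAS.ap_of_cover (A : OPAS E) {T S : E} (s : S ⟶ T) [StrongEpi s] {a b : T ⟶ A.carrier}
    {c : S ⟶ A.carrier} (h : c ∈ A.ap (s ≫ a) (s ≫ b)) : ∃ d ∈ A.ap a b, s ≫ d = c := by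
  obtain ⟨h, hc⟩ := h
  have e : prod.lift (s ≫ a) (s ≫ b) = s ≫ prod.lift a b := by ext <;> simp
  have hd : A.dom.Factors (s ≫ prod.lift a b) := e ▸ h
  have h' : A.dom.Factors (prod.lift a b) := factors_of_cover s _ _ hd
  exact ⟨_, ⟨h', rfl⟩, Part.mem_unique (A.ap_comp s ⟨h', rfl⟩) ⟨h, hc⟩⟩

lemma OPAS.ap_mono (A : OPAS E) {T : E} {a b a' b' c' : T ⟶ A.carrier} (ha : A.Le a a')
    (hb : A.Le b b') (h : c' ∈ A.ap a' b') : ∃ c ∈ A.ap a b, A.Le c c' := by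
  obtain ⟨h, rfl⟩ := h
  obtain ⟨h1, h2⟩ := A.app_mono a b a' b' ha hb h
  exact ⟨_, ⟨h1, rfl⟩, h2⟩

end Facts

section Facts

variable {E : Type u} [Category.{v} E] [Regular E]

lemma isRegularEpi_of_strongEpi {X Y : E} (f : X ⟶ Y) [StrongEpi f] : IsRegularEpi f :=
  inferInstance

lemma inhabited_of_map {X Y : E} (f : X ⟶ Y) (h : IsInhabited X) : IsInhabited Y := by
  have h' : IsRegularEpi (terminal.from X) := h
  have : StrongEpi (f ≫ terminal.from Y) := by
    rw [Subsingleton.elim (f ≫ terminal.from Y) (terminal.from X)]; infer_instance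
  have := strongEpi_of_strongEpi f (terminal.from Y)
  exact isRegularEpi_of_strongEpi _

lemma strongEpi_snd {X : E} (h : IsInhabited X) (Y : E) : StrongEpi (prod.snd : X ⨯ Y ⟶ Y) := by
  have h' : IsRegularEpi (terminal.from X) := h
  have sq : IsPullback (prod.fst : X ⨯ Y ⟶ X) prod.snd (terminal.from X) (terminal.from Y) :=
    IsPullback.of_is_product' (prodIsProd X Y) terminalIsTerminal
  have : IsRegularEpi (prod.snd : X ⨯ Y ⟶ Y) :=
    Regular.regularEpiIsStableUnderBaseChange.of_isPullback sq h'
  infer_instance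

lemma inhabited_prod {X Y : E} (hX : IsInhabited X) (hY : IsInhabited Y) : IsInhabited (X ⨯ Y) := by
  have := strongEpi_snd hX Y
  have h' : IsRegularEpi (terminal.from Y) := hY
  have : StrongEpi ((prod.snd : X ⨯ Y ⟶ Y) ≫ terminal.from Y) := inferInstance
  rw [Subsingleton.elim (prod.snd ≫ terminal.from Y) (terminal.from (X ⨯ Y))] at this
  exact isRegularEpi_of_strongEpi _

lemma intersects_of_factors {X T : E} (hT : IsInhabited T) (x : T ⟶ X) {U V : Subobject X}
    (hU : U.Factors x) (hV : V.Factors x) : Intersects U V :=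
  inhabited_of_map (Subobject.factorThru (U ⊓ V) x ((Subobject.inf_factors x).2 ⟨hU, hV⟩)) hT

/-- An inhabited `T` and a generalized element of `U ∩ V` over it. -/
lemma Intersects.exists_element {X : E} {U V : Subobject X} (h : Intersects U V) :
    ∃ (T : E) (x : T ⟶ X), IsInhabited T ∧ U.Factors x ∧ V.Factors x :=
  ⟨_, (U ⊓ V).arrow, h, (Subobject.inf_factors _).1 (Subobject.factors_self _)⟩

/-- To track `f` it suffices to have a generalized element of `A'` over an inhabited object that
does so. -/
lemma tracked_of_element {P : OPCAPair E} {X X' : Asm P} (f : X.obj ⟶ X'.obj) {Q : E}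
    (hQ : IsInhabited Q) (w : Q ⟶ P.carrier) (hw : P.sub.Factors w)
    (H : ∀ {T : E} (q : T ⟶ Q) (b : T ⟶ P.carrier) (x : T ⟶ X.obj),
      X.rel.Factors (prod.lift b x) →
        ∃ c ∈ P.ap (q ≫ w) b, X'.rel.Factors (prod.lift c (x ≫ f))) :
    ∃ V : Subobject P.carrier, Intersects V P.sub ∧ Tracks (X := X) (X' := X') V f := by
  obtain ⟨I, m, e₀, hm, he₀, hF⟩ : ∃ (I : E) (m : I ⟶ P.carrier) (e₀ : Q ⟶ I),
      Mono m ∧ IsRegularEpi e₀ ∧ e₀ ≫ m = w :=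
    let F := Regular.strongEpiMonoFactorisation w
    ⟨F.I, F.m, F.e, F.m_mono, inferInstance, F.fac⟩
  refine ⟨Subobject.mk m, intersects_of_factors hQ w ?_ hw, ?_⟩
  · rw [← hF]
    exact Subobject.factors_of_factors_right _ (Subobject.mk_factors_self _)
  · intro T a b x ha hx
    obtain ⟨a', rfl⟩ : ∃ a' : T ⟶ I, a' ≫ m = a := by
      exact ⟨_, ((Subobject.mk_factors_iff m a).1 ha).choose_spec⟩
    let e : pullback e₀ a' ⟶ T := pullback.snd _ _
    have he : StrongEpi e := inferInstance
    have hx' : X.rel.Factors (prod.lift (e ≫ b) (e ≫ x)) := by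
      have := Subobject.factors_of_factors_right e hx
      rwa [prod.comp_lift] at this
    obtain ⟨c, hc, hc'⟩ := H (pullback.fst e₀ a') (e ≫ b) (e ≫ x) hx'
    have hq : pullback.fst e₀ a' ≫ w = e ≫ a' ≫ m := by
      rw [← hF, ← Category.assoc, pullback.condition, Category.assoc]
    rw [hq] at hc
    obtain ⟨d, hd, rfl⟩ := P.ap_of_cover e hc
    refine ⟨d, hd, factors_of_cover e _ _ ?_⟩
    rwa [prod.comp_lift, ← Category.assoc]

/-- Generalized elements of `A'` that realize `t`. -/
lemma OPCAPair.exists_realizer (P : OPCAPair E) {n : ℕ} (t : CombTerm n) :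
    ∃ (Q : E) (r : Q ⟶ P.carrier), IsInhabited Q ∧ P.sub.Factors r ∧
      ∀ {S : E} (s : S ⟶ Q) (x : Fin n → (S ⟶ P.carrier)),
        (P.apList (s ≫ r) (List.ofFn x).dropLast).Dom ∧
        ∀ y ∈ P.eval x t, ∃ z ∈ P.apList (s ≫ r) (List.ofFn x), P.Le z y := by
  obtain ⟨R, hR, hRA⟩ := P.combinatory t
  obtain ⟨Q, r, hQ, hr, hr'⟩ := hRA.exists_element
  exact ⟨Q, r, hQ, hr', (hR r).1 hr⟩

/-- Generalized elements of `A'` that realize the identity. -/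
lemma OPCAPair.exists_id (P : OPCAPair E) :
    ∃ (Q : E) (r : Q ⟶ P.carrier), IsInhabited Q ∧ P.sub.Factors r ∧
      ∀ {S : E} (s : S ⟶ Q) (b : S ⟶ P.carrier), ∃ z ∈ P.ap (s ≫ r) b, P.Le z b := by
  obtain ⟨Q, r, hQ, hr, H⟩ := P.exists_realizer (CombTerm.var (0 : Fin 1))
  refine ⟨Q, r, hQ, hr, fun s b => ?_⟩
  obtain ⟨z, hz, hzb⟩ := (H s (fun _ => b)).2 b (by simp [OPAS.eval])
  refine ⟨z, ?_, hzb⟩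
  simpa [OPAS.apList] using hz

lemma tracked_id {P : OPCAPair E} (X : Asm P) :
    ∃ V : Subobject P.carrier, Intersects V P.sub ∧ Tracks (X := X) (X' := X) V (𝟙 X.obj) := by
  obtain ⟨Q, r, hQ, hr, H⟩ := P.exists_id
  refine tracked_of_element _ hQ r hr fun q b x hx => ?_
  obtain ⟨z, hz, hzb⟩ := H q b
  exact ⟨z, hz, by simpa using X.down _ _ _ hx hzb⟩

lemma tracked_comp {P : OPCAPair E} {X Y Z : Asm P} (f : X.Hom Y) (g : Y.Hom Z) :
    ∃ V : Subobject P.carrier, Intersects V P.sub ∧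
      Tracks (X := X) (X' := Z) V (f.hom ≫ g.hom) := by
  obtain ⟨U, hU, hUf⟩ := f.tracked
  obtain ⟨V, hV, hVg⟩ := g.tracked
  obtain ⟨Q₁, u, hQ₁, huU, hu⟩ := hU.exists_element
  obtain ⟨Q₂, v, hQ₂, hvV, hv⟩ := hV.exists_element
  obtain ⟨Q₃, β, hQ₃, hβ, H⟩ := P.exists_realizer
    (CombTerm.app (.var (0 : Fin 3)) (.app (.var 1) (.var 2)))
  let Q := Q₁ ⨯ (Q₂ ⨯ Q₃)
  let p₁ : Q ⟶ Q₁ := prod.fst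
  let p₂ : Q ⟶ Q₂ := prod.snd ≫ prod.fst
  let p₃ : Q ⟶ Q₃ := prod.snd ≫ prod.snd
  have hQ : IsInhabited Q := inhabited_prod hQ₁ (inhabited_prod hQ₂ hQ₃)
  obtain ⟨w, hw⟩ : ∃ w, w ∈ P.apList (p₃ ≫ β) [p₂ ≫ v, p₁ ≫ u] := by
    have := (H p₃ ![p₂ ≫ v, p₁ ≫ u, p₁ ≫ u]).1
    exact Part.dom_iff_mem.1 (by simpa using this)
  simp only [OPAS.apList, Part.bind_some_right, Part.mem_bind_iff] at hw
  obtain ⟨w₁, hw₁, hw⟩ := hw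
  have hwA : P.sub.Factors w := by
    refine P.sub_closed _ _ _ (P.sub_closed _ _ _ ?_ ?_ hw₁) ?_ hw
    all_goals exact Subobject.factors_of_factors_right _ (by assumption)
  refine tracked_of_element _ hQ w hwA fun {T} q b x hx => ?_
  obtain ⟨c, hc, hcY⟩ := hUf (q ≫ p₁ ≫ u) b x
    (Subobject.factors_of_factors_right _ (Subobject.factors_of_factors_right _ huU)) hx
  obtain ⟨d, hd, hdZ⟩ := hVg (q ≫ p₂ ≫ v) c _
    (Subobject.factors_of_factors_right _ (Subobject.factors_of_factors_right _ hvV)) hcY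
  obtain ⟨z, hz, hzd⟩ := (H (q ≫ p₃) ![q ≫ p₂ ≫ v, q ≫ p₁ ≫ u, b]).2 d (by
    simp only [OPAS.eval, Part.bind_some, Part.mem_bind_iff]
    exact ⟨c, by simpa using hc, by simpa using hd⟩)
  refine ⟨z, ?_, by simpa using Z.down _ _ _ hdZ hzd⟩
  have e : (List.ofFn ![q ≫ p₂ ≫ v, q ≫ p₁ ≫ u, b]) = [q ≫ p₂ ≫ v, q ≫ p₁ ≫ u, b] := by simp
  rw [e] at hz
  simp only [OPAS.apList, Part.bind_some_right, Part.mem_bind_iff] at hz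
  obtain ⟨z₁, hz₁, z₂, hz₂, hz⟩ := hz
  have e₁ : z₁ = q ≫ w₁ := by
    refine Part.mem_unique hz₁ ?_
    simpa using P.ap_comp q hw₁
  subst e₁
  have e₂ : z₂ = q ≫ w := Part.mem_unique hz₂ (P.ap_comp q hw)
  subst e₂
  exact hz

end Facts

section Category

variable {E : Type u} [Category.{v} E] [HeytingCategory E]

/-- The category `Asm(A', A)` of assemblies. -/
instance (P : OPCAPair E) : Category (Asm P) where
  Hom X Y := X.Hom Y
  id X := ⟨𝟙 X.obj, tracked_id X⟩
  comp f g := ⟨f.hom ≫ g.hom, tracked_comp f g⟩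
  id_comp _ := Asm.Hom.ext (Category.id_comp _)
  comp_id _ := Asm.Hom.ext (Category.comp_id _)
  assoc _ _ _ := Asm.Hom.ext (Category.assoc _ _ _)

/-- The forgetful functor `D : Asm(A', A) ⥤ E`, `(X, Y) ↦ X`. -/
def domainFunctor (P : OPCAPair E) : Asm P ⥤ E where
  obj X := X.obj
  map f := Asm.Hom.hom f
  map_id _ := rfl
  map_comp _ _ := rfl

lemma OPCAPair.inhabited (P : OPCAPair E) : IsInhabited P.carrier := by
  obtain ⟨Q, r, hQ, -, -⟩ := P.exists_id
  exact inhabited_of_map r hQ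

/-- The assembly `∇X = (X, A × X)`. -/
def nablaObj (P : OPCAPair E) (X : E) : Asm P where
  obj := X
  rel := ⊤
  total := by
    have := strongEpi_snd P.inhabited X
    exact isRegularEpi_of_strongEpi _
  down _ _ _ _ _ := Subobject.top_factors _

lemma tracked_nabla (P : OPCAPair E) {X Y : E} (f : X ⟶ Y) :
    ∃ V : Subobject P.carrier, Intersects V P.sub ∧
      Tracks (X := nablaObj P X) (X' := nablaObj P Y) V f := by
  obtain ⟨Q, r, hQ, hr, H⟩ := P.exists_id
  refine tracked_of_element _ hQ r hr fun q b x _ => ?_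
  obtain ⟨z, hz, -⟩ := H q b
  exact ⟨z, hz, Subobject.top_factors _⟩

/-- The functor `∇ : E ⥤ Asm(A', A)`, `X ↦ (X, A × X)`, `f ↦ f`. -/
def nabla (P : OPCAPair E) : E ⥤ Asm P where
  obj X := nablaObj P X
  map f := ⟨f, tracked_nabla P f⟩
  map_id _ := rfl
  map_comp _ _ := rfl

end Category

end RelRealizability

end

open RelRealizability

noncomputable section

namespace RelRealizability

attribute [local simp] prod.lift_fst prod.lift_snd prod.lift_fst_assoc prod.lift_snd_assoc

/-! The argument is realizability done in Kripke–Joyal style. Internal statements become statements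
on generalized elements: an existential holds after passing to a strong epimorphic cover, and a
universal is interpreted by the right adjoints of inverse images (`exists_forallSub`). A tracker in
`A'` is a generalized element of `A'` over an inhabited object, since no global one need exist.
`RelTracked` expresses this for bare relations, and `relTracked_of_term` turns applicative terms
with parameters in `A'` into trackers.

`D ⊣ ∇` holds because every arrow of `E` from `X.obj` to `Y` is tracked as a map to `∇Y`. Pullbacks
are those of `E`, with realizers that code pairs (`conjRel`). A morphism is a regular epimorphism
iff its underlying arrow is one and realizers lift uniformly (`isRegularEpi_asm_iff`). This gives
stability under pullback, images, and regularity of `∇`; `D` preserves finite limits by construction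
and regular epimorphisms as a left adjoint.

For the Heyting structure, subobjects of `X` are replaced by downward closed relations that refine
the realizability relation of `X`, preordered by trackability of the identity (`le_iff_relTracked`,
`exists_subobject`). By `exists_trackRel`, being tracked by a fixed `w` is an inequality `R ≤ U`, so
bottom and joins can be built from those of `E`, for joins after tagging the realizers. Right
adjoints come from the usual realizability clause for `∀` (`exists_forallRel`), implication from `∀`
along a monomorphism, and left adjoints from images. -/

lemma factors_mk_comp {E : Type u} [Category.{v} E] {G I X : E} (m : I ⟶ X) [Mono m] (e : G ⟶ I) :
    (Subobject.mk m).Factors (e ≫ m) :=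
  Subobject.factors_of_factors_right _ (Subobject.mk_factors_self _)

lemma le_iff_factors {E : Type u} [Category.{v} E] {X : E} {U V : Subobject X} :
    U ≤ V ↔ ∀ {T : E} (x : T ⟶ X), U.Factors x → V.Factors x :=
  ⟨fun h _ _ hx => Subobject.factors_of_le _ h hx, fun h => Subobject.le_of_factors (h _ U.factors_self)⟩

/-! ### Generalized elements in a regular category -/

section Regular

variable {E : Type u} [Category.{v} E] [Regular E]

lemma exists_strongEpi_mono {G X : E} (f : G ⟶ X) :
    ∃ (I : E) (e : G ⟶ I) (m : I ⟶ X), StrongEpi e ∧ Mono m ∧ e ≫ m = f :=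
  let F := Regular.strongEpiMonoFactorisation f
  ⟨F.I, F.e, F.m, inferInstance, F.m_mono, F.fac⟩

/-- The image of `π`, in terms of generalized elements. -/
lemma exists_imageSub {G X : E} (π : G ⟶ X) : ∃ W : Subobject X, ∀ {T : E} (x : T ⟶ X),
    W.Factors x ↔ ∃ (S : E) (e : S ⟶ T) (g : S ⟶ G), StrongEpi e ∧ g ≫ π = e ≫ x := by
  obtain ⟨I, e, m, he, hm, rfl⟩ := exists_strongEpi_mono π
  refine ⟨Subobject.mk m, fun {T} x => ⟨fun h => ?_, ?_⟩⟩
  · obtain ⟨y, hy⟩ : ∃ y : T ⟶ I, y ≫ m = x :=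
      ⟨_, ((Subobject.mk_factors_iff m x).1 h).choose_spec⟩
    exact ⟨_, pullback.snd e y, pullback.fst e y, inferInstance, by
      rw [← hy, ← Category.assoc, pullback.condition, Category.assoc]⟩
  · rintro ⟨S, s, g, hs, hg⟩
    refine factors_of_cover s _ _ ?_
    rw [← hg, ← Category.assoc]
    exact factors_mk_comp _ _

/-- A map is a strong epimorphism iff it is locally surjective on generalized elements. -/
lemma strongEpi_iff_locally_surjective {G X : E} (π : G ⟶ X) :
    StrongEpi π ↔ ∀ {T : E} (x : T ⟶ X),
      ∃ (S : E) (e : S ⟶ T) (g : S ⟶ G), StrongEpi e ∧ g ≫ π = e ≫ x := by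
  refine ⟨fun h T x => ⟨_, pullback.snd π x, pullback.fst π x, inferInstance,
    pullback.condition⟩, fun h => ?_⟩
  -- The generic element lifts along a cover, so a strong epimorphism factors through `π`.
  obtain ⟨S, e, g, he, hg⟩ := h (𝟙 X)
  rw [Category.comp_id] at hg
  subst hg
  exact strongEpi_of_strongEpi g π

lemma isRegularEpi_iff_strongEpi {X Y : E} (f : X ⟶ Y) : IsRegularEpi f ↔ StrongEpi f :=
  ⟨fun _ => inferInstance, fun _ => isRegularEpi_of_strongEpi f⟩

/-- The projection of a relation is a regular epimorphism iff the relation is total. -/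
lemma isRegularEpi_proj_iff {A X : E} (R : Subobject (A ⨯ X)) :
    IsRegularEpi (R.arrow ≫ prod.snd) ↔ ∀ {T : E} (x : T ⟶ X),
      ∃ (S : E) (e : S ⟶ T) (a : S ⟶ A), StrongEpi e ∧ R.Factors (prod.lift a (e ≫ x)) := by
  rw [isRegularEpi_iff_strongEpi, strongEpi_iff_locally_surjective]
  refine forall_congr' fun T => forall_congr' fun x => exists_congr fun S =>
    exists_congr fun e => ⟨?_, ?_⟩
  · rintro ⟨g, he, hg⟩
    refine ⟨g ≫ R.arrow ≫ prod.fst, he, ?_⟩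
    rw [← hg, show prod.lift (g ≫ R.arrow ≫ prod.fst) (g ≫ R.arrow ≫ prod.snd) = g ≫ R.arrow by
      ext <;> simp]
    exact Subobject.factors_comp_arrow _
  · rintro ⟨a, he, ha⟩
    exact ⟨R.factorThru _ ha, he, by simp⟩

/-- A common refinement of two covers of `T`. -/
lemma exists_common_cover {T S S' : E} (e : S ⟶ T) (e' : S' ⟶ T) [StrongEpi e] [StrongEpi e'] :
    ∃ (Q : E) (p : Q ⟶ S) (p' : Q ⟶ S'), StrongEpi p ∧ StrongEpi p' ∧ StrongEpi (p ≫ e) ∧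
      p ≫ e = p' ≫ e' :=
  ⟨_, pullback.fst e e', pullback.snd e e', inferInstance, inferInstance, inferInstance,
    pullback.condition⟩

lemma lift_factors_comp {A X T S : E} {R : Subobject (A ⨯ X)} {a : T ⟶ A} {x : T ⟶ X}
    (s : S ⟶ T) (h : R.Factors (prod.lift a x)) : R.Factors (prod.lift (s ≫ a) (s ≫ x)) := by
  rw [← prod.comp_lift]
  exact Subobject.factors_of_factors_right s h

lemma lift_factors_of_cover {A X T S : E} {R : Subobject (A ⨯ X)} {a : T ⟶ A} {x : T ⟶ X}
    (s : S ⟶ T) [StrongEpi s] (h : R.Factors (prod.lift (s ≫ a) (s ≫ x))) :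
    R.Factors (prod.lift a x) := by
  rw [← prod.comp_lift] at h
  exact factors_of_cover s _ _ h

lemma pullback_factors_iff {X Y T : E} (f : X ⟶ Y) (U : Subobject Y) (x : T ⟶ X) :
    ((Subobject.pullback f).obj U).Factors x ↔ U.Factors (x ≫ f) := by
  refine ⟨fun h => ?_, fun h => ?_⟩
  · rw [← Subobject.factorThru_arrow _ _ h, Category.assoc, ← (Subobject.isPullback f U).w,
      ← Category.assoc]
    exact Subobject.factors_comp_arrow _
  · rw [← (Subobject.isPullback f U).lift_snd (U.factorThru _ h) x (by simp)]
    exact Subobject.factors_comp_arrow _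

lemma le_iff_factors_lift {A X : E} {R S : Subobject (A ⨯ X)} :
    R ≤ S ↔ ∀ {T : E} (a : T ⟶ A) (x : T ⟶ X),
      R.Factors (prod.lift a x) → S.Factors (prod.lift a x) := by
  refine ⟨fun h _ _ _ hx => Subobject.factors_of_le _ h hx, fun h => le_iff_factors.2 fun {T} x hx => ?_⟩
  have e : x = prod.lift (x ≫ prod.fst) (x ≫ prod.snd) := by ext <;> simp
  rw [e] at hx ⊢
  exact h _ _ hx

/-- The subobject of those `g` for which `ab` is defined and `(ab, x)` belongs to `S`, where
`a`, `b` and `x` depend on `g`. -/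
lemma OPAS.exists_apSub (A : OPAS E) {G Y : E} (a b : G ⟶ A.carrier) (y : G ⟶ Y)
    (S : Subobject (A.carrier ⨯ Y)) : ∃ U : Subobject G, ∀ {T : E} (g : T ⟶ G),
      U.Factors g ↔ ∃ c ∈ A.ap (g ≫ a) (g ≫ b), S.Factors (prod.lift c (g ≫ y)) := by
  -- `P` is the locus in `G` where `ab` is defined; the condition on `S` is imposed there and the
  -- result is viewed in `G`.
  let P := pullback A.dom.arrow (prod.lift a b)
  let i : P ⟶ G := pullback.snd _ _
  let k : P ⟶ (A.dom : E) := pullback.fst _ _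
  have hki : k ≫ A.dom.arrow = i ≫ prod.lift a b := pullback.condition
  let m : P ⟶ A.carrier ⨯ Y := prod.lift (k ≫ A.app) (i ≫ y)
  have key : ∀ {T : E} (p : T ⟶ P), p ≫ k ≫ A.app ∈ A.ap ((p ≫ i) ≫ a) ((p ≫ i) ≫ b) := by
    intro T p
    have e : prod.lift ((p ≫ i) ≫ a) ((p ≫ i) ≫ b) = (p ≫ k) ≫ A.dom.arrow := by
      rw [Category.assoc p k, hki]; ext <;> simp
    have h : A.dom.Factors (prod.lift ((p ≫ i) ≫ a) ((p ≫ i) ≫ b)) := by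
      rw [e]; exact Subobject.factors_comp_arrow _
    refine ⟨h, ?_⟩
    change A.dom.factorThru _ h ≫ A.app = _
    rw [← Category.assoc]
    congr 1
    rw [← cancel_mono A.dom.arrow, Subobject.factorThru_arrow, e]
  refine ⟨Subobject.mk (((Subobject.pullback m).obj S).arrow ≫ i), fun {T} g => ⟨fun h => ?_, ?_⟩⟩
  · obtain ⟨p, rfl⟩ : ∃ p, p ≫ ((Subobject.pullback m).obj S).arrow ≫ i = g :=
      ⟨_, ((Subobject.mk_factors_iff _ g).1 h).choose_spec⟩
    refine ⟨_, by simpa using key (p ≫ ((Subobject.pullback m).obj S).arrow), ?_⟩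
    have : ((Subobject.pullback m).obj S).Factors (p ≫ ((Subobject.pullback m).obj S).arrow) :=
      Subobject.factors_comp_arrow _
    rw [pullback_factors_iff] at this
    simpa [m] using this
  · rintro ⟨c, hc, hS⟩
    have hd : A.dom.Factors (prod.lift (g ≫ a) (g ≫ b)) := hc.1
    obtain ⟨p, hp⟩ : ∃ p : T ⟶ P, p ≫ i = g :=
      ⟨pullback.lift (A.dom.factorThru _ hd) g (by simp), pullback.lift_snd _ _ _⟩
    subst hp
    obtain rfl := Part.mem_unique hc (key p)
    have : ((Subobject.pullback m).obj S).Factors p := by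
      rw [pullback_factors_iff]
      simpa [m] using hS
    rw [← Subobject.factorThru_arrow _ _ this, Category.assoc]
    exact factors_mk_comp _ _

end Regular

/-! ### Universal quantification -/

section Heyting

variable {E : Type u} [Category.{v} E] [HeytingCategory E]

/-- Universal quantification along `π`, in terms of generalized elements. -/
lemma exists_forallSub {G X : E} (π : G ⟶ X) (U : Subobject G) :
    ∃ W : Subobject X, ∀ {T : E} (x : T ⟶ X),
      W.Factors x ↔ ∀ {S : E} (s : S ⟶ T) (g : S ⟶ G), g ≫ π = s ≫ x → U.Factors g := by
  obtain ⟨r, hr⟩ := HeytingCategory.exists_rightAdjoint π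
  refine ⟨r U, fun {T} x => ⟨fun h S s g hg => ?_, fun h => ?_⟩⟩
  · refine Subobject.factors_of_le _ (hr.l_u_le U) ((pullback_factors_iff _ _ _).2 ?_)
    rw [hg]
    exact Subobject.factors_of_factors_right s h
  -- The adjunction speaks of subobjects only, so `x` is replaced by its image `m`. An element over
  -- `m` lifts to `T` only after pulling back the cover `e`, which suffices for membership in `U`.
  · obtain ⟨I, e, m, he, hm, rfl⟩ := exists_strongEpi_mono x
    refine Subobject.factors_of_le _ ((hr _ _).1 ?_) (factors_mk_comp m e)
    refine le_iff_factors.2 fun {S} g hg => ?_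
    rw [pullback_factors_iff] at hg
    obtain ⟨y, hy⟩ : ∃ y : S ⟶ I, y ≫ m = g ≫ π :=
      ⟨_, ((Subobject.mk_factors_iff m _).1 hg).choose_spec⟩
    refine factors_of_cover (pullback.snd e y) _ _ (h (pullback.fst e y) _ ?_)
    rw [Category.assoc, ← hy, ← Category.assoc, ← pullback.condition, Category.assoc]

end Heyting

/-! ### Applicative terms on generalized elements -/

section Terms

variable {E : Type u} [Category.{v} E] [HasFiniteLimits E] (A : OPAS E)

lemma OPAS.apList_append {T : E} (a : T ⟶ A.carrier) (l m : List (T ⟶ A.carrier)) :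
    A.apList a (l ++ m) = (A.apList a l).bind fun b => A.apList b m := by
  induction l generalizing a with
  | nil => simp [OPAS.apList]
  | cons y l ih => simp [OPAS.apList, ih, Part.bind_assoc]

lemma OPAS.apList_comp {T S : E} (s : S ⟶ T) {a c : T ⟶ A.carrier} {l : List (T ⟶ A.carrier)}
    (h : c ∈ A.apList a l) : s ≫ c ∈ A.apList (s ≫ a) (l.map (s ≫ ·)) := by
  induction l generalizing a with
  | nil =>
    rw [OPAS.apList, Part.mem_some_iff] at h
    simp [OPAS.apList, h]
  | cons y l ih =>
    simp only [OPAS.apList, Part.mem_bind_iff, List.map_cons] at h ⊢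
    obtain ⟨b, hb, hc⟩ := h
    exact ⟨_, A.ap_comp s hb, ih hc⟩

lemma OPAS.mem_eval_var {T : E} {n : ℕ} (x : Fin n → (T ⟶ A.carrier)) (i : Fin n) :
    x i ∈ A.eval x (.var i) :=
  Part.mem_some _

variable {A} in
lemma OPAS.mem_eval_app {T : E} {n : ℕ} {x : Fin n → (T ⟶ A.carrier)} {s t : CombTerm n}
    {a b c : T ⟶ A.carrier} (ha : a ∈ A.eval x s) (hb : b ∈ A.eval x t) (hc : c ∈ A.ap a b) :
    c ∈ A.eval x (.app s t) :=
  Part.mem_bind_iff.2 ⟨a, ha, Part.mem_bind_iff.2 ⟨b, hb, hc⟩⟩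

lemma OPAS.mem_apList_cons {T : E} {a b c : T ⟶ A.carrier} {l : List (T ⟶ A.carrier)} :
    c ∈ A.apList a (b :: l) ↔ ∃ d ∈ A.ap a b, c ∈ A.apList d l := by
  simp [OPAS.apList]

/-- A relation between realizers and elements is downward closed. -/
def OPAS.IsDown {X : E} (R : Subobject (A.carrier ⨯ X)) : Prop :=
  ∀ {T : E} (a b : T ⟶ A.carrier) (x : T ⟶ X), R.Factors (prod.lift a x) → A.Le b a →
    R.Factors (prod.lift b x)

lemma OPAS.le_comp {T S : E} (s : S ⟶ T) {a b : T ⟶ A.carrier} (h : A.Le a b) :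
    A.Le (s ≫ a) (s ≫ b) := by
  unfold OPAS.Le
  rw [← prod.comp_lift]
  exact Subobject.factors_of_factors_right s h

end Terms

/-! ### Realizers of partial combinatory arrows of arity two and three -/

section Pairs

variable {E : Type u} [Category.{v} E] [HasFiniteLimits E] (P : OPCAPair E)

lemma OPCAPair.sub_apList {T : E} {a c : T ⟶ P.carrier} {l : List (T ⟶ P.carrier)}
    (ha : P.sub.Factors a) (hl : ∀ b ∈ l, P.sub.Factors b) (h : c ∈ P.apList a l) :
    P.sub.Factors c := by
  induction l generalizing a with
  | nil =>
    rw [OPAS.apList, Part.mem_some_iff] at h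
    exact h ▸ ha
  | cons y l ih =>
    obtain ⟨b, hb, hc⟩ := (OPAS.mem_apList_cons _).1 h
    exact ih (P.sub_closed _ _ _ ha (hl y (by simp)) hb) (fun z hz => hl z (by simp [hz])) hc

/-- The object of realizers of a partial combinatory arrow. -/
def OPCAPair.realizers {n : ℕ} (t : CombTerm n) : Subobject P.carrier :=
  (P.combinatory t).choose

lemma OPCAPair.isRealizerObject {n : ℕ} (t : CombTerm n) :
    P.IsRealizerObject t (P.realizers t) :=
  (P.combinatory t).choose_spec.1

lemma OPCAPair.intersects_realizers {n : ℕ} (t : CombTerm n) :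
    Intersects (P.realizers t) P.sub :=
  (P.combinatory t).choose_spec.2

variable {P}

lemma OPCAPair.exists_of_realizer_two {t : CombTerm 2} {T : E} {r : T ⟶ P.carrier}
    (hr : (P.realizers t).Factors r) (b c : T ⟶ P.carrier) :
    ∃ d ∈ P.ap r b, ∀ y ∈ P.eval ![b, c] t, ∃ z ∈ P.ap d c, P.Le z y := by
  obtain ⟨h, h'⟩ := (P.isRealizerObject t r).1 hr (𝟙 T) ![b, c]
  obtain ⟨d, hd⟩ := Part.dom_iff_mem.1 h
  have hd : d ∈ P.ap r b := by simpa [OPAS.mem_apList_cons, OPAS.apList] using hd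
  refine ⟨d, hd, fun y hy => ?_⟩
  obtain ⟨z, hz, hzy⟩ := h' y hy
  obtain ⟨d', hd', hz⟩ : ∃ d ∈ P.ap r b, z ∈ P.ap d c := by
    simpa [OPAS.apList] using hz
  exact ⟨z, Part.mem_unique hd' hd ▸ hz, hzy⟩

/-- The partial applications are fixed over `T`, while the last argument may live over any `S ⟶ T`.
A code `e` can thus be built before the element that it is applied to is known. -/
lemma OPCAPair.exists_of_realizer_three {t : CombTerm 3} {T : E} {r : T ⟶ P.carrier}
    (hr : (P.realizers t).Factors r) (b c : T ⟶ P.carrier) :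
    ∃ d ∈ P.ap r b, ∃ e ∈ P.ap d c, ∀ {S : E} (s : S ⟶ T) (x : S ⟶ P.carrier),
      ∀ y ∈ P.eval ![s ≫ b, s ≫ c, x] t, ∃ z ∈ P.ap (s ≫ e) x, P.Le z y := by
  -- The third entry is a dummy, removed by `dropLast`.
  have h := ((P.isRealizerObject t r).1 hr (𝟙 T) ![b, c, c]).1
  obtain ⟨e, he⟩ := Part.dom_iff_mem.1 h
  obtain ⟨d, hd, he⟩ : ∃ d ∈ P.ap r b, e ∈ P.ap d c := by
    simpa [OPAS.apList] using he
  refine ⟨d, hd, e, he, fun {S} s x y hy => ?_⟩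
  obtain ⟨z, hz, hzy⟩ := ((P.isRealizerObject t r).1 hr s ![s ≫ b, s ≫ c, x]).2 y hy
  obtain ⟨d', hd', e', he', hz⟩ : ∃ d ∈ P.ap (s ≫ r) (s ≫ b), ∃ e ∈ P.ap d (s ≫ c),
      z ∈ P.ap e x := by
    simpa [OPAS.apList] using hz
  obtain rfl := Part.mem_unique hd' (P.ap_comp s hd)
  obtain rfl := Part.mem_unique he' (P.ap_comp s he)
  exact ⟨z, hz, hzy⟩

end Pairs

/-! ### Trackers for bare relations -/

section Tracking

variable {E : Type u} [Category.{v} E] [Regular E] (P : OPCAPair E)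

/-- Every partial combinatory arrow of which the first arguments are fixed elements of `A'` has
realizers in `A'`. -/
lemma OPCAPair.exists_partial_realizer {n m : ℕ} (t : CombTerm (n + (m + 1))) {Q : E}
    (hQ : IsInhabited Q) (w : Fin n → (Q ⟶ P.carrier)) (hw : ∀ i, P.sub.Factors (w i)) :
    ∃ (Q' : E) (p : Q' ⟶ Q) (r : Q' ⟶ P.carrier), IsInhabited Q' ∧ P.sub.Factors r ∧
      ∀ {S : E} (s : S ⟶ Q') (x : Fin (m + 1) → (S ⟶ P.carrier)),
        (P.apList (s ≫ r) (List.ofFn x).dropLast).Dom ∧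
        ∀ y ∈ P.eval (Fin.append (fun i => (s ≫ p) ≫ w i) x) t,
          ∃ z ∈ P.apList (s ≫ r) (List.ofFn x), P.Le z y := by
  obtain ⟨Q₀, r₀, hQ₀, hr₀, H⟩ := P.exists_realizer t
  have key : ∀ {S : E} (s : S ⟶ Q ⨯ Q₀) (x : Fin (m + 1) → (S ⟶ P.carrier)),
      List.ofFn (Fin.append (fun i => (s ≫ prod.fst) ≫ w i) x) =
        (List.ofFn fun i => (s ≫ prod.fst) ≫ w i) ++ List.ofFn x := fun s x =>
    List.ofFn_fin_append _ _
  have hne : ∀ {S : E} (x : Fin (m + 1) → (S ⟶ P.carrier)), List.ofFn x ≠ [] := fun x => by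
    simp
  obtain ⟨r, hr⟩ : ∃ r, r ∈ P.apList (prod.snd ≫ r₀)
      (List.ofFn fun i => (prod.fst : Q ⨯ Q₀ ⟶ Q) ≫ w i) := by
    -- At least one argument stays free, so applying `r₀` to the fixed ones is always defined. The
    -- free arguments are filled with a dummy.
    have := (H (prod.snd : Q ⨯ Q₀ ⟶ Q₀) (Fin.append (fun i => (𝟙 _ ≫ prod.fst) ≫ w i)
      fun _ => prod.snd ≫ r₀)).1
    rw [key, List.dropLast_append_of_ne_nil (hne _), OPAS.apList_append] at this
    simp only [Category.id_comp] at this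
    exact Part.dom_iff_mem.1 (Part.Dom.of_bind this)
  have hr' : ∀ {S : E} (s : S ⟶ Q ⨯ Q₀), s ≫ r ∈ P.apList ((s ≫ prod.snd) ≫ r₀)
      (List.ofFn fun i => (s ≫ prod.fst) ≫ w i) := fun s => by
    have := P.apList_comp s hr
    simpa [List.map_ofFn, Function.comp_def] using this
  refine ⟨Q ⨯ Q₀, prod.fst, r, inhabited_prod hQ hQ₀, ?_, fun {S} s x => ?_⟩
  · refine P.sub_apList (Subobject.factors_of_factors_right _ hr₀) (fun b hb => ?_) hr
    obtain ⟨i, rfl⟩ := (List.mem_ofFn' _ _).1 hb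
    exact Subobject.factors_of_factors_right _ (hw i)
  · have := H (s ≫ prod.snd) (Fin.append (fun i => (s ≫ prod.fst) ≫ w i) x)
    rw [key, List.dropLast_append_of_ne_nil (hne _), OPAS.apList_append, OPAS.apList_append,
      Part.eq_some_iff.2 (hr' s), Part.bind_some, Part.bind_some] at this
    exact this

variable {P} in
/-- `w` tracks `f` with respect to the relations `R` and `S`. -/
def TracksBy {X Y Q : E} (w : Q ⟶ P.carrier) (R : Subobject (P.carrier ⨯ X))
    (S : Subobject (P.carrier ⨯ Y)) (f : X ⟶ Y) : Prop :=
  ∀ {T : E} (q : T ⟶ Q) (b : T ⟶ P.carrier) (x : T ⟶ X), R.Factors (prod.lift b x) →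
    ∃ c ∈ P.ap (q ≫ w) b, S.Factors (prod.lift c (x ≫ f))

variable {P} in
lemma TracksBy.comp {X Y Q Q' : E} {w : Q ⟶ P.carrier} {R : Subobject (P.carrier ⨯ X)}
    {S : Subobject (P.carrier ⨯ Y)} {f : X ⟶ Y} (h : TracksBy w R S f) (s : Q' ⟶ Q) :
    TracksBy (s ≫ w) R S f := fun q b x hx => by
  simpa using h (q ≫ s) b x hx

/-- Some generalized elements of `A'` over an inhabited object track `f` with respect to the
relations `R` and `S`. -/
def RelTracked {X Y : E} (R : Subobject (P.carrier ⨯ X)) (S : Subobject (P.carrier ⨯ Y))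
    (f : X ⟶ Y) : Prop :=
  ∃ (Q : E) (w : Q ⟶ P.carrier), IsInhabited Q ∧ P.sub.Factors w ∧ TracksBy w R S f

variable {P}

/-- From left to right `V` is the image of `w`; conversely `w` is the generic element of `V ∩ A'`.
-/
lemma relTracked_iff {X X' : Asm P} (f : X.obj ⟶ X'.obj) :
    RelTracked P X.rel X'.rel f ↔
      ∃ V : Subobject P.carrier, Intersects V P.sub ∧ Tracks (X := X) (X' := X') V f := by
  constructor
  · rintro ⟨Q, w, hQ, hw, H⟩
    exact tracked_of_element f hQ w hw H
  · rintro ⟨V, hV, H⟩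
    obtain ⟨Q, w, hQ, hwV, hw⟩ := hV.exists_element
    exact ⟨Q, w, hQ, hw, fun q b x hx =>
      H _ _ _ (Subobject.factors_of_factors_right q hwV) hx⟩

variable {X Y Z : E} {R : Subobject (P.carrier ⨯ X)} {S : Subobject (P.carrier ⨯ Y)}
  {S' : Subobject (P.carrier ⨯ Z)} {f : X ⟶ Y} {g : Y ⟶ Z}

/-- Realizers compute the value of `t` only up to `≤`, which is why `S` must be downward closed. -/
lemma relTracked_of_term {n : ℕ} (t : CombTerm (n + 1)) (hS : P.IsDown S) {Q : E}
    (hQ : IsInhabited Q) (w : Fin n → (Q ⟶ P.carrier)) (hw : ∀ i, P.sub.Factors (w i))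
    (H : ∀ {T : E} (q : T ⟶ Q) (b : T ⟶ P.carrier) (x : T ⟶ X), R.Factors (prod.lift b x) →
      ∃ y ∈ P.eval (Fin.append (fun i => q ≫ w i) ![b]) t,
        S.Factors (prod.lift y (x ≫ f))) : RelTracked P R S f := by
  obtain ⟨Q', p, r, hQ', hr, H'⟩ := P.exists_partial_realizer (m := 0) t hQ w hw
  refine ⟨Q', r, hQ', hr, fun {T} q b x hx => ?_⟩
  obtain ⟨y, hy, hyS⟩ := H (q ≫ p) b x hx
  obtain ⟨z, hz, hzy⟩ := (H' q ![b]).2 y hy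
  exact ⟨z, by simpa [OPAS.apList] using hz, hS _ _ _ hyS hzy⟩

/-- A tracker with two arguments. -/
lemma exists_of_term_two {n : ℕ} (t : CombTerm (n + 2)) {Q : E}
    (hQ : IsInhabited Q) (w : Fin n → (Q ⟶ P.carrier)) (hw : ∀ i, P.sub.Factors (w i)) :
    ∃ (Q' : E) (p : Q' ⟶ Q) (r : Q' ⟶ P.carrier), IsInhabited Q' ∧ P.sub.Factors r ∧
      ∀ {T : E} (q : T ⟶ Q') (a : T ⟶ P.carrier), ∃ d ∈ P.ap (q ≫ r) a,
        ∀ {S : E} (s : S ⟶ T) (b : S ⟶ P.carrier),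
          ∀ y ∈ P.eval (Fin.append (fun i => (s ≫ q ≫ p) ≫ w i) ![s ≫ a, b]) t,
            ∃ z ∈ P.ap (s ≫ d) b, P.Le z y := by
  obtain ⟨Q', p, r, hQ', hr, H⟩ := P.exists_partial_realizer (m := 1) t hQ w hw
  refine ⟨Q', p, r, hQ', hr, fun {T} q a => ?_⟩
  -- The second `a` is a dummy.
  obtain ⟨d, hd⟩ := Part.dom_iff_mem.1 (H q ![a, a]).1
  have hd : d ∈ P.ap (q ≫ r) a := by simpa [OPAS.apList] using hd
  refine ⟨d, hd, fun {S} s b y hy => ?_⟩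
  obtain ⟨z, hz, hzy⟩ := (H (s ≫ q) ![s ≫ a, b]).2 y (by simpa using hy)
  obtain ⟨d', hd', hz⟩ : ∃ d ∈ P.ap (s ≫ q ≫ r) (s ≫ a), z ∈ P.ap d b := by
    simpa [OPAS.apList] using hz
  obtain rfl := Part.mem_unique hd' (P.ap_comp s hd)
  exact ⟨z, hz, hzy⟩

lemma relTracked_of_le (hS : P.IsDown S)
    (h : ∀ {T : E} (b : T ⟶ P.carrier) (x : T ⟶ X), R.Factors (prod.lift b x) →
      S.Factors (prod.lift b (x ≫ f))) : RelTracked P R S f := by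
  obtain ⟨Q, r, hQ, hr, H⟩ := P.exists_id
  refine ⟨Q, r, hQ, hr, fun q b x hx => ?_⟩
  obtain ⟨z, hz, hzb⟩ := H q b
  exact ⟨z, hz, hS _ _ _ (h _ _ hx) hzb⟩

lemma RelTracked.congr {f' : X ⟶ Y} (h : RelTracked P R S f) (e : f = f') :
    RelTracked P R S f' :=
  e ▸ h

lemma RelTracked.comp (hS' : P.IsDown S') (h : RelTracked P R S f) (h' : RelTracked P S S' g) :
    RelTracked P R S' (f ≫ g) := by
  obtain ⟨Q₁, u, hQ₁, hu, H₁⟩ := h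
  obtain ⟨Q₂, v, hQ₂, hv, H₂⟩ := h'
  refine relTracked_of_term (.app (.var (1 : Fin 3)) (.app (.var 0) (.var 2))) hS'
    (inhabited_prod hQ₁ hQ₂) ![prod.fst ≫ u, prod.snd ≫ v] (fun i => ?_) fun q b x hx => ?_
  · fin_cases i
    exacts [Subobject.factors_of_factors_right _ hu, Subobject.factors_of_factors_right _ hv]
  · obtain ⟨c, hc, hcS⟩ := H₁.comp prod.fst q b x hx
    obtain ⟨d, hd, hdS⟩ := H₂.comp prod.snd q c _ hcS
    refine ⟨d, OPAS.mem_eval_app (OPAS.mem_eval_var _ _ _)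
      (OPAS.mem_eval_app (OPAS.mem_eval_var _ _ _) (OPAS.mem_eval_var _ _ _) hc) hd, ?_⟩
    simpa using hdS

end Tracking

/-! ### Morphisms of assemblies and the adjunction -/

section Morphisms

variable {E : Type u} [Category.{v} E] [HeytingCategory E] {P : OPCAPair E}

/-- The underlying arrow of a morphism of assemblies. -/
abbrev Asm.under {X Y : Asm P} (f : X ⟶ Y) : X.obj ⟶ Y.obj := Asm.Hom.hom f

@[ext]
lemma Asm.hom_ext {X Y : Asm P} {f g : X ⟶ Y} (h : Asm.under f = Asm.under g) : f = g :=
  Asm.Hom.ext h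

@[simp]
lemma Asm.under_comp {X Y Z : Asm P} (f : X ⟶ Y) (g : Y ⟶ Z) :
    Asm.under (f ≫ g) = Asm.under f ≫ Asm.under g :=
  rfl

/-- A tracked arrow is a morphism of assemblies. -/
def Asm.mkHom {X Y : Asm P} (f : X.obj ⟶ Y.obj) (h : RelTracked P X.rel Y.rel f) : X ⟶ Y :=
  ⟨f, (relTracked_iff f).1 h⟩

lemma Asm.relTracked {X Y : Asm P} (f : X ⟶ Y) : RelTracked P X.rel Y.rel (Asm.under f) :=
  (relTracked_iff _).2 (Asm.Hom.tracked f)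

lemma Asm.isDown (X : Asm P) : P.IsDown X.rel := X.down

lemma Asm.exists_rel (X : Asm P) {T : E} (x : T ⟶ X.obj) :
    ∃ (S : E) (e : S ⟶ T) (a : S ⟶ P.carrier), StrongEpi e ∧
      X.rel.Factors (prod.lift a (e ≫ x)) :=
  (isRegularEpi_proj_iff X.rel).1 X.total x

instance : (domainFunctor P).Faithful where
  map_injective h := Asm.hom_ext h

lemma Asm.mono_of_under {X Y : Asm P} (f : X ⟶ Y) [h : Mono (Asm.under f)] : Mono f :=
  have : Mono ((domainFunctor P).map f) := h
  (domainFunctor P).mono_of_mono_map this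

lemma Asm.epi_of_under {X Y : Asm P} (f : X ⟶ Y) [h : Epi (Asm.under f)] : Epi f :=
  have : Epi ((domainFunctor P).map f) := h
  (domainFunctor P).epi_of_epi_map this

variable (P) in
/-- Every arrow from the underlying object of an assembly is tracked as an arrow to `∇Y`. -/
lemma relTracked_top {X Y : E} (R : Subobject (P.carrier ⨯ X)) (f : X ⟶ Y) :
    RelTracked P R ⊤ f :=
  relTracked_of_le (fun _ _ _ _ _ => Subobject.top_factors _) fun _ _ _ => Subobject.top_factors _

variable (P) in
/-- The functor `∇` is a right adjoint of `D`. -/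
def domainNablaAdjunction : domainFunctor P ⊣ nabla P :=
  Adjunction.mkOfHomEquiv
    { homEquiv _ Y :=
        { toFun f := Asm.mkHom (Y := nablaObj P Y) f (relTracked_top P _ _)
          invFun f := Asm.under f
          left_inv _ := rfl
          right_inv _ := rfl }
      homEquiv_naturality_left_symm _ _ := rfl
      homEquiv_naturality_right _ _ := rfl }

instance : HasTerminal (Asm P) :=
  have := (domainNablaAdjunction P).rightAdjoint_preservesLimits
  (terminalIsTerminal.isTerminalObj (nabla P)).hasTerminal

end Morphisms

/-! ### Pairing of realizers -/

section Conj

variable {E : Type u} [Category.{v} E] [HeytingCategory E] (P : OPCAPair E)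

/-- The realizers of the projections `A² ⇀ A`. -/
abbrev OPCAPair.projRealizers (i : Fin 2) : Subobject P.carrier := P.realizers (.var i)

/-- The realizers of the pairing operation `(x, y, z) ↦ z x y`. -/
abbrev OPCAPair.pairRealizers : Subobject P.carrier :=
  P.realizers (.app (.app (.var (2 : Fin 3)) (.var 0)) (.var 1))

/-- Quantifying over all realizers `k` of the projection avoids choosing one, which might be
possible only over some inhabited object. -/
lemma exists_projRel (i : Fin 2) {X Y : E} (f : X ⟶ Y) (S : Subobject (P.carrier ⨯ Y)) :
    ∃ U : Subobject (P.carrier ⨯ X), ∀ {T : E} (a : T ⟶ P.carrier) (x : T ⟶ X),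
      U.Factors (prod.lift a x) ↔ ∀ {T' : E} (s : T' ⟶ T) (k : T' ⟶ P.carrier),
        (P.projRealizers i).Factors k →
          ∃ c ∈ P.ap (s ≫ a) k, S.Factors (prod.lift c (s ≫ x ≫ f)) := by
  let G := (P.carrier ⨯ X) ⨯ (P.projRealizers i : E)
  obtain ⟨V, hV⟩ := P.exists_apSub (G := G) (prod.fst ≫ prod.fst)
    (prod.snd ≫ (P.projRealizers i).arrow) (prod.fst ≫ prod.snd ≫ f) S
  obtain ⟨U, hU⟩ := exists_forallSub (G := G) prod.fst V
  refine ⟨U, fun {T} a x => ?_⟩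
  rw [hU]
  constructor
  · intro h T' s k hk
    have := h s (prod.lift (prod.lift (s ≫ a) (s ≫ x)) ((P.projRealizers i).factorThru k hk))
      (by rw [prod.lift_fst, prod.comp_lift])
    rw [hV] at this
    simpa using this
  · intro h T' s g hg
    rw [hV]
    obtain ⟨c, hc, hc'⟩ := h s (g ≫ prod.snd ≫ (P.projRealizers i).arrow)
      (by rw [← Category.assoc]; exact Subobject.factors_comp_arrow _)
    have e₁ : g ≫ prod.fst ≫ prod.fst = s ≫ a := by rw [← Category.assoc, hg]; simp
    have e₂ : g ≫ prod.fst ≫ prod.snd ≫ f = s ≫ x ≫ f := by rw [← Category.assoc, hg]; simp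
    exact ⟨c, by rwa [e₁], by rwa [e₂]⟩

/-- The relation of those `(a, x)` for which `ak` realizes `f x` for all realizers `k` of a
projection. -/
def projRel (i : Fin 2) {X Y : E} (f : X ⟶ Y) (S : Subobject (P.carrier ⨯ Y)) :
    Subobject (P.carrier ⨯ X) :=
  (exists_projRel P i f S).choose

variable {P}

lemma projRel_factors {i : Fin 2} {X Y : E} {f : X ⟶ Y} {S : Subobject (P.carrier ⨯ Y)} {T : E}
    {a : T ⟶ P.carrier} {x : T ⟶ X} :
    (projRel P i f S).Factors (prod.lift a x) ↔ ∀ {T' : E} (s : T' ⟶ T) (k : T' ⟶ P.carrier),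
      (P.projRealizers i).Factors k →
        ∃ c ∈ P.ap (s ≫ a) k, S.Factors (prod.lift c (s ≫ x ≫ f)) :=
  (exists_projRel P i f S).choose_spec a x

lemma OPAS.le_rfl (A : OPAS E) {T : E} (a : T ⟶ A.carrier) : A.Le a a := A.le_refl a

variable {X Y Z W : E} {f : X ⟶ Y} {g : X ⟶ Z} {S₁ : Subobject (P.carrier ⨯ Y)}
  {S₂ : Subobject (P.carrier ⨯ Z)}

lemma projRel_isDown (i : Fin 2) (h₁ : P.IsDown S₁) : P.IsDown (projRel P i f S₁) := by
  intro T a b x hx hab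
  rw [projRel_factors] at hx ⊢
  intro T' s k hk
  obtain ⟨c, hc, hcS⟩ := hx s k hk
  obtain ⟨d, hd, hdc⟩ := P.ap_mono (P.le_comp s hab) (P.le_rfl k) hc
  exact ⟨d, hd, h₁ _ _ _ hcS hdc⟩

lemma relTracked_projRel (i : Fin 2) (h₁ : P.IsDown S₁) :
    RelTracked P (projRel P i f S₁) S₁ f := by
  obtain ⟨Q, k, hQ, hk, hk'⟩ := (P.intersects_realizers (.var i : CombTerm 2)).exists_element
  refine relTracked_of_term (.app (.var (1 : Fin 2)) (.var 0)) h₁ hQ ![k]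
    (fun i => by fin_cases i; exact hk') fun {T} q b x hx => ?_
  obtain ⟨c, hc, hcS⟩ := projRel_factors.1 hx (𝟙 T) (q ≫ k)
    (Subobject.factors_of_factors_right _ hk)
  rw [Category.id_comp] at hc
  exact ⟨c, OPAS.mem_eval_app (OPAS.mem_eval_var _ _ _) (OPAS.mem_eval_var _ _ _) hc,
    by simpa using hcS⟩

variable (P) in
/-- The relation of those `(a, x)` for which `a` codes a pair of realizers of `f x` and `g x`. -/
def conjRel (f : X ⟶ Y) (S₁ : Subobject (P.carrier ⨯ Y)) (g : X ⟶ Z)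
    (S₂ : Subobject (P.carrier ⨯ Z)) : Subobject (P.carrier ⨯ X) :=
  projRel P 0 f S₁ ⊓ projRel P 1 g S₂

lemma conjRel_isDown (h₁ : P.IsDown S₁) (h₂ : P.IsDown S₂) :
    P.IsDown (conjRel P f S₁ g S₂) := by
  intro T a b x hx hab
  obtain ⟨hx, hx'⟩ := (Subobject.inf_factors _).1 hx
  exact (Subobject.inf_factors _).2
    ⟨projRel_isDown 0 h₁ _ _ _ hx hab, projRel_isDown 1 h₂ _ _ _ hx' hab⟩

lemma relTracked_conjRel_fst (h₁ : P.IsDown S₁) : RelTracked P (conjRel P f S₁ g S₂) S₁ f := by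
  obtain ⟨Q, w, hQ, hw, H⟩ := relTracked_projRel (f := f) 0 h₁
  exact ⟨Q, w, hQ, hw, fun q b x hx => H q b x ((Subobject.inf_factors _).1 hx).1⟩

lemma relTracked_conjRel_snd (h₂ : P.IsDown S₂) : RelTracked P (conjRel P f S₁ g S₂) S₂ g := by
  obtain ⟨Q, w, hQ, hw, H⟩ := relTracked_projRel (f := g) 1 h₂
  exact ⟨Q, w, hQ, hw, fun q b x hx => H q b x ((Subobject.inf_factors _).1 hx).2⟩

/-- Take `e = pbc`. For a realizer `k` of a projection, `ek ≤ kbc`, and `kbc` lies below `b` or `c`;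
downward closure does the rest. -/
lemma exists_pair (h₁ : P.IsDown S₁) (h₂ : P.IsDown S₂) {T : E} {p b c : T ⟶ P.carrier}
    (hp : P.pairRealizers.Factors p) :
    ∃ d ∈ P.ap p b, ∃ e ∈ P.ap d c, ∀ {T' : E} (s : T' ⟶ T) (x : T' ⟶ X),
      S₁.Factors (prod.lift (s ≫ b) (x ≫ f)) → S₂.Factors (prod.lift (s ≫ c) (x ≫ g)) →
        (conjRel P f S₁ g S₂).Factors (prod.lift (s ≫ e) x) := by
  obtain ⟨d, hd, e, he, H⟩ := P.exists_of_realizer_three hp b c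
  refine ⟨d, hd, e, he, fun {T'} s x hb hc => (Subobject.inf_factors _).2
    ⟨projRel_factors.2 fun {T''} s' k hk => ?_, projRel_factors.2 fun {T''} s' k hk => ?_⟩⟩
  all_goals
    obtain ⟨y, hy, H'⟩ := P.exists_of_realizer_two hk ((s' ≫ s) ≫ b) ((s' ≫ s) ≫ c)
    obtain ⟨z, hz, hzb⟩ := H' _ (P.mem_eval_var _ _)
    obtain ⟨z', hz', hzz'⟩ := H (s' ≫ s) k z (OPAS.mem_eval_app (OPAS.mem_eval_app
      (P.mem_eval_var _ _) (P.mem_eval_var _ _) hy) (P.mem_eval_var _ _) hz)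
    refine ⟨z', by simpa using hz', ?_⟩
  · refine h₁ _ _ _ (h₁ _ _ _ (lift_factors_comp s' hb) ?_) hzz'
    rw [← Category.assoc]
    exact hzb
  · refine h₂ _ _ _ (h₂ _ _ _ (lift_factors_comp s' hc) ?_) hzz'
    rw [← Category.assoc]
    exact hzb

lemma exists_pairRealizer (P : OPCAPair E) : ∃ (Q : E) (p : Q ⟶ P.carrier), IsInhabited Q ∧
    P.pairRealizers.Factors p ∧ P.sub.Factors p :=
  (P.intersects_realizers _).exists_element

/-- The tracker is `x ↦ p(ux)(vx)`. The arrow `h` is arbitrary so that this serves both the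
universal property of pullbacks and, with an identity, meets of relations. -/
lemma relTracked_conjRel (h₁ : P.IsDown S₁) (h₂ : P.IsDown S₂) {R : Subobject (P.carrier ⨯ W)}
    {h : W ⟶ X} (H₁ : RelTracked P R S₁ (h ≫ f)) (H₂ : RelTracked P R S₂ (h ≫ g)) :
    RelTracked P R (conjRel P f S₁ g S₂) h := by
  obtain ⟨Q₁, u, hQ₁, hu, H₁⟩ := H₁
  obtain ⟨Q₂, v, hQ₂, hv, H₂⟩ := H₂
  obtain ⟨Q₃, p, hQ₃, hp, hp'⟩ := exists_pairRealizer P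
  refine relTracked_of_term (.app (.app (.var (0 : Fin 4)) (.app (.var 1) (.var 3)))
    (.app (.var 2) (.var 3))) (conjRel_isDown h₁ h₂)
    (inhabited_prod hQ₁ (inhabited_prod hQ₂ hQ₃))
    ![(prod.snd ≫ prod.snd) ≫ p, prod.fst ≫ u, (prod.snd ≫ prod.fst) ≫ v]
    (fun i => ?_) fun {T} q b x hx => ?_
  · fin_cases i <;> exact Subobject.factors_of_factors_right _ (by assumption)
  · obtain ⟨c, hc, hcS⟩ := H₁.comp prod.fst q b x hx
    obtain ⟨d, hd, hdS⟩ := H₂.comp (prod.snd ≫ prod.fst) q b x hx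
    obtain ⟨y, hy, z, hz, H⟩ := exists_pair (b := c) (c := d) (f := f) (g := g) h₁ h₂
      (Subobject.factors_of_factors_right (q ≫ prod.snd ≫ prod.snd) hp)
    refine ⟨z, OPAS.mem_eval_app (OPAS.mem_eval_app (P.mem_eval_var _ _)
      (OPAS.mem_eval_app (P.mem_eval_var _ _) (P.mem_eval_var _ _) hc) (c := y) ?_)
      (OPAS.mem_eval_app (P.mem_eval_var _ _) (P.mem_eval_var _ _) hd) hz, ?_⟩
    · rw [Category.assoc] at hy
      exact hy
    · simpa using H (𝟙 T) (x ≫ h) (by simpa using hcS) (by simpa using hdS)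

end Conj

/-! ### Finite limits of assemblies -/

section Pullbacks

variable {E : Type u} [Category.{v} E] [HeytingCategory E] {P : OPCAPair E} {X Y Z : Asm P}

/-- The pullback of assemblies. -/
def pullbackAsm (f : X ⟶ Z) (g : Y ⟶ Z) : Asm P where
  obj := pullback (Asm.under f) (Asm.under g)
  rel := conjRel P (pullback.fst _ _) X.rel (pullback.snd _ _) Y.rel
  total := by
    rw [isRegularEpi_proj_iff]
    intro T x
    obtain ⟨S₁, e₁, a, he₁, ha⟩ := X.exists_rel (x ≫ pullback.fst _ _)
    obtain ⟨S₂, e₂, b, he₂, hb⟩ := Y.exists_rel (x ≫ pullback.snd _ _)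
    obtain ⟨S, p₁, p₂, -, -, hp, e⟩ := exists_common_cover e₁ e₂
    obtain ⟨Q, p, hQ, hp', -⟩ := exists_pairRealizer P
    -- Since `Q` is inhabited, `Q ⨯ S` still covers `S`, and over it a pairing element is available.
    have := strongEpi_snd hQ S
    let t : Q ⨯ S ⟶ S := prod.snd
    obtain ⟨-, -, c, -, H⟩ := exists_pair (b := t ≫ p₁ ≫ a) (c := t ≫ p₂ ≫ b) (T := Q ⨯ S)
      (f := pullback.fst (Asm.under f) (Asm.under g)) (g := pullback.snd _ _) X.isDown Y.isDown
      (Subobject.factors_of_factors_right (prod.fst) hp')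
    refine ⟨Q ⨯ S, t ≫ p₁ ≫ e₁, c, inferInstance, ?_⟩
    have := H (𝟙 _) ((t ≫ p₁ ≫ e₁) ≫ x)
      (by simpa using lift_factors_comp (t ≫ p₁) ha)
      (by rw [e]; simpa using lift_factors_comp (t ≫ p₂) hb)
    simpa using this
  down := conjRel_isDown X.isDown Y.isDown

/-- The first projection of the pullback of assemblies. -/
def pullbackAsmFst (f : X ⟶ Z) (g : Y ⟶ Z) : pullbackAsm f g ⟶ X :=
  Asm.mkHom (X := pullbackAsm f g) (pullback.fst (Asm.under f) (Asm.under g))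
    (relTracked_conjRel_fst X.isDown)

/-- The second projection of the pullback of assemblies. -/
def pullbackAsmSnd (f : X ⟶ Z) (g : Y ⟶ Z) : pullbackAsm f g ⟶ Y :=
  Asm.mkHom (X := pullbackAsm f g) (pullback.snd (Asm.under f) (Asm.under g))
    (relTracked_conjRel_snd Y.isDown)

lemma isPullback_under (f : X ⟶ Z) (g : Y ⟶ Z) : IsPullback (Asm.under (pullbackAsmFst f g))
    (Asm.under (pullbackAsmSnd f g)) (Asm.under f) (Asm.under g) :=
  IsPullback.of_hasPullback (Asm.under f) (Asm.under g)

lemma isPullback_pullbackAsm (f : X ⟶ Z) (g : Y ⟶ Z) :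
    IsPullback (pullbackAsmFst f g) (pullbackAsmSnd f g) f g where
  w := Asm.hom_ext (isPullback_under f g).w
  isLimit' := ⟨PullbackCone.IsLimit.mk _
    (fun s => Asm.mkHom (Y := pullbackAsm f g)
      (pullback.lift (Asm.under s.fst) (Asm.under s.snd) (congrArg Asm.under s.condition))
      (relTracked_conjRel X.isDown Y.isDown
        ((Asm.relTracked s.fst).congr (pullback.lift_fst _ _ _).symm)
        ((Asm.relTracked s.snd).congr (pullback.lift_snd _ _ _).symm)))
    (fun _ => Asm.hom_ext (pullback.lift_fst _ _ _))
    (fun _ => Asm.hom_ext (pullback.lift_snd _ _ _))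
    (fun _ _ h₁ h₂ => Asm.hom_ext (pullback.hom_ext
      ((congrArg Asm.under h₁).trans (pullback.lift_fst _ _ _).symm)
      ((congrArg Asm.under h₂).trans (pullback.lift_snd _ _ _).symm)))⟩

instance : HasPullbacks (Asm P) :=
  have (X Y Z : Asm P) (f : X ⟶ Z) (g : Y ⟶ Z) : HasPullback f g :=
    (isPullback_pullbackAsm f g).hasPullback
  hasPullbacks_of_hasLimit_cospan _

instance : HasFiniteLimits (Asm P) := hasFiniteLimits_of_hasTerminal_and_pullbacks

instance : PreservesLimitsOfShape WalkingCospan (domainFunctor P) where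
  preservesLimit {K} := by
    have (X Y Z : Asm P) (f : X ⟶ Z) (g : Y ⟶ Z) :
        PreservesLimit (cospan f g) (domainFunctor P) := by
      refine preservesLimit_of_preserves_limit_cone (isPullback_pullbackAsm f g).isLimit ?_
      exact (isLimitMapConePullbackConeEquiv (domainFunctor P)
        (isPullback_pullbackAsm f g).w).symm (isPullback_under f g).isLimit
    exact preservesLimit_of_iso_diagram _ (diagramIsoCospan K).symm

instance : PreservesFiniteLimits (domainFunctor P) := by
  have : PreservesLimit (Functor.empty.{0} (Asm P)) (domainFunctor P) := by
    have := (domainNablaAdjunction P).rightAdjoint_preservesLimits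
    exact preservesLimit_of_preserves_limit_cone
      (terminalIsTerminal.isTerminalObj (nabla P))
      ((isLimitMapConeEmptyConeEquiv _ _).symm terminalIsTerminal)
  have := preservesLimitsOfShape_pempty_of_preservesTerminal (domainFunctor P)
  exact preservesFiniteLimits_of_preservesTerminal_and_pullbacks _

end Pullbacks

/-! ### Direct images of relations -/

section Image

variable {E : Type u} [Category.{v} E] [Regular E]

lemma exists_imRel {A X Y : E} (f : X ⟶ Y) (R : Subobject (A ⨯ X)) :
    ∃ U : Subobject (A ⨯ Y), ∀ {T : E} (a : T ⟶ A) (y : T ⟶ Y),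
      U.Factors (prod.lift a y) ↔ ∃ (S : E) (e : S ⟶ T) (x : S ⟶ X), StrongEpi e ∧
        x ≫ f = e ≫ y ∧ R.Factors (prod.lift (e ≫ a) x) := by
  obtain ⟨U, hU⟩ := exists_imageSub (R.arrow ≫ prod.lift prod.fst (prod.snd ≫ f))
  refine ⟨U, fun {T} a y => (hU _).trans (exists_congr fun S => exists_congr fun e => ⟨?_, ?_⟩)⟩
  · rintro ⟨g, he, hg⟩
    have h₁ := congrArg (· ≫ prod.fst) hg
    have h₂ := congrArg (· ≫ prod.snd) hg
    simp only [Category.assoc, prod.lift_fst, prod.lift_snd] at h₁ h₂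
    refine ⟨g ≫ R.arrow ≫ prod.snd, he, by simpa using h₂, ?_⟩
    rw [← h₁, show prod.lift (g ≫ R.arrow ≫ prod.fst) (g ≫ R.arrow ≫ prod.snd) = g ≫ R.arrow by
      ext <;> simp]
    exact Subobject.factors_comp_arrow _
  · rintro ⟨x, he, hx, hR⟩
    exact ⟨R.factorThru _ hR, he, by ext <;> simp [hx]⟩

/-- The direct image of a relation. -/
def imRel {A X Y : E} (f : X ⟶ Y) (R : Subobject (A ⨯ X)) : Subobject (A ⨯ Y) :=
  (exists_imRel f R).choose

lemma imRel_factors {A X Y : E} {f : X ⟶ Y} {R : Subobject (A ⨯ X)} {T : E} {a : T ⟶ A}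
    {y : T ⟶ Y} : (imRel f R).Factors (prod.lift a y) ↔
      ∃ (S : E) (e : S ⟶ T) (x : S ⟶ X), StrongEpi e ∧
        x ≫ f = e ≫ y ∧ R.Factors (prod.lift (e ≫ a) x) :=
  (exists_imRel f R).choose_spec a y

lemma imRel_factors_of_factors {A X Y : E} (f : X ⟶ Y) {R : Subobject (A ⨯ X)} {T : E}
    {a : T ⟶ A} {x : T ⟶ X} (h : R.Factors (prod.lift a x)) :
    (imRel f R).Factors (prod.lift a (x ≫ f)) :=
  imRel_factors.2 ⟨T, 𝟙 T, x, inferInstance, by simp, by simpa using h⟩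

variable {P : OPCAPair E} {X Y Z : E} {f : X ⟶ Y} {g : Y ⟶ Z} {R : Subobject (P.carrier ⨯ X)}
  {S : Subobject (P.carrier ⨯ Z)}

lemma imRel_isDown (hR : P.IsDown R) : P.IsDown (imRel f R) := by
  intro T a b y hy hab
  obtain ⟨S, e, x, he, hx, hxR⟩ := imRel_factors.1 hy
  exact imRel_factors.2 ⟨S, e, x, he, hx, hR _ _ _ hxR (P.le_comp e hab)⟩

/-- A preimage of `y` exists only on a cover, but the value `wb` does not depend on it, so it
descends. -/
lemma TracksBy.of_imRel {Q : E} {w : Q ⟶ P.carrier} (h : TracksBy w R S (f ≫ g)) :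
    TracksBy w (imRel f R) S g := by
  intro T q b y hy
  obtain ⟨S', e, x, he, hx, hxR⟩ := imRel_factors.1 hy
  obtain ⟨c, hc, hcS⟩ := h (e ≫ q) (e ≫ b) x hxR
  rw [Category.assoc] at hc
  obtain ⟨d, hd, rfl⟩ := P.ap_of_cover e hc
  refine ⟨d, hd, lift_factors_of_cover e ?_⟩
  rwa [← Category.assoc, ← hx, Category.assoc]

lemma RelTracked.of_imRel (h : RelTracked P R S (f ≫ g)) : RelTracked P (imRel f R) S g := by
  obtain ⟨Q, w, hQ, hw, H⟩ := h
  exact ⟨Q, w, hQ, hw, H.of_imRel⟩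

end Image

/-! ### Regular epimorphisms and regularity -/

section RegularEpis

variable {E : Type u} [Category.{v} E] [HeytingCategory E] {P : OPCAPair E}

/-- The image of an assembly along a strong epimorphism. -/
def imageAsm (X : Asm P) {I : E} (e : X.obj ⟶ I) [StrongEpi e] : Asm P where
  obj := I
  rel := imRel e X.rel
  total := by
    rw [isRegularEpi_proj_iff]
    intro T y
    obtain ⟨S, s, x, hs, hx⟩ := (strongEpi_iff_locally_surjective e).1 inferInstance y
    obtain ⟨S', s', a, hs', ha⟩ := X.exists_rel x
    refine ⟨S', s' ≫ s, a, inferInstance, ?_⟩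
    rw [Category.assoc, ← hx, ← Category.assoc]
    exact imRel_factors_of_factors e ha
  down := imRel_isDown X.isDown

/-- The map onto the image of an assembly. -/
def imageAsmMap (X : Asm P) {I : E} (e : X.obj ⟶ I) [StrongEpi e] : X ⟶ imageAsm X e :=
  Asm.mkHom (Y := imageAsm X e) e
    (relTracked_of_le (imRel_isDown X.isDown) fun _ _ => imRel_factors_of_factors e)

/-- `D` is a left adjoint, so it preserves the coequalizer that exhibits `f` as a regular
epimorphism. -/
lemma strongEpi_under {X Y : Asm P} (f : X ⟶ Y) [IsRegularEpi f] :
    StrongEpi (Asm.under f) := by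
  have := (domainNablaAdjunction P).leftAdjoint_preservesColimits
  have h := isColimitCoforkMapOfIsColimit (domainFunctor P) _ (IsRegularEpi.isColimit f)
  have : IsRegularEpi ((domainFunctor P).map f) := ⟨⟨Cofork.IsColimit.regularEpi h⟩⟩
  exact inferInstanceAs (StrongEpi ((domainFunctor P).map f))

/-- A morphism of assemblies is a regular epimorphism iff its underlying arrow is one and realizers
in the codomain can be lifted uniformly. -/
lemma isRegularEpi_asm_iff {X Y : Asm P} (f : X ⟶ Y) :
    IsRegularEpi f ↔ StrongEpi (Asm.under f) ∧
      RelTracked P Y.rel (imRel (Asm.under f) X.rel) (𝟙 Y.obj) := by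
  constructor
  · intro hf
    have := strongEpi_under f
    -- `m` is monic because its underlying arrow is an identity, and a strong epimorphism because
    -- `f` factors through it. So it is invertible, and a tracker of its inverse lifts the realizers
    -- of `Y`.
    let m : imageAsm X (Asm.under f) ⟶ Y := Asm.mkHom (X := imageAsm X (Asm.under f)) (𝟙 Y.obj)
      (RelTracked.of_imRel ((Asm.relTracked f).congr (Category.comp_id _).symm))
    have hm : Mono (Asm.under m) := inferInstanceAs (Mono (𝟙 Y.obj))
    have : Mono m := Asm.mono_of_under m
    have hem : imageAsmMap X (Asm.under f) ≫ m = f := Asm.hom_ext (Category.comp_id _)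
    have : StrongEpi (imageAsmMap X (Asm.under f) ≫ m) := by rw [hem]; infer_instance
    have : StrongEpi m := strongEpi_of_strongEpi (imageAsmMap X (Asm.under f)) m
    have : IsIso m := isIso_of_mono_of_strongEpi m
    have h : Asm.under (inv m) = 𝟙 Y.obj :=
      (Category.comp_id (Asm.under (inv m))).symm.trans (congrArg Asm.under (IsIso.inv_hom_id m))
    exact ⟨inferInstance, (Asm.relTracked (inv m)).congr h⟩
  · rintro ⟨hf, H⟩
    have : Epi f := Asm.epi_of_under f
    refine IsRegularEpi.of_epi_of_exists fun W g hg => ?_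
    have : IsRegularEpi (Asm.under f) := isRegularEpi_of_strongEpi _
    -- `D` preserves the kernel pair, so `g` descends in `E`. The descended arrow is tracked by
    -- lifting realizers with `H` and then applying a tracker of `g`.
    have hk : IsKernelPair (Asm.under f) (Asm.under (pullback.fst f f))
        (Asm.under (pullback.snd f f)) :=
      (IsPullback.of_hasPullback f f).map (domainFunctor P)
    obtain ⟨u, hu⟩ := IsRegularEpi.exists_of_isKernelPair (Asm.under f) hk (Asm.under g)
      (congrArg Asm.under hg)
    refine ⟨Asm.mkHom u ?_, Asm.hom_ext hu⟩
    exact (H.comp W.isDown (RelTracked.of_imRel ((Asm.relTracked g).congr hu.symm))).congr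
      (Category.id_comp _)

instance (X : Asm P) {I : E} (e : X.obj ⟶ I) [StrongEpi e] : IsRegularEpi (imageAsmMap X e) :=
  (isRegularEpi_asm_iff _).2 ⟨inferInstanceAs (StrongEpi e),
    relTracked_of_le (imRel_isDown X.isDown) fun _ _ h => by rwa [Category.comp_id]⟩

/-- If `u` tracks `f` and `v` lifts realizers along `g`, then `b ↦ p b (v(ub))` lifts realizers
along the projection. -/
lemma isRegularEpi_pullbackAsmFst {X Y Z : Asm P} (f : X ⟶ Z) (g : Y ⟶ Z) [IsRegularEpi g] :
    IsRegularEpi (pullbackAsmFst f g) := by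
  obtain ⟨hg, Q₂, v, hQ₂, hv, H₂⟩ := (isRegularEpi_asm_iff g).1 inferInstance
  obtain ⟨Q₁, u, hQ₁, hu, H₁⟩ := Asm.relTracked f
  refine (isRegularEpi_asm_iff _).2
    ⟨inferInstanceAs (StrongEpi (pullback.fst (Asm.under f) (Asm.under g))), ?_⟩
  obtain ⟨Q₃, p, hQ₃, hp, hp'⟩ := exists_pairRealizer P
  refine relTracked_of_term (.app (.app (.var (0 : Fin 4)) (.var 3))
    (.app (.var 2) (.app (.var 1) (.var 3)))) (imRel_isDown (pullbackAsm f g).isDown)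
    (inhabited_prod hQ₁ (inhabited_prod hQ₂ hQ₃))
    ![(prod.snd ≫ prod.snd) ≫ p, prod.fst ≫ u, (prod.snd ≫ prod.fst) ≫ v]
    (fun i => ?_) fun {T} q b x hx => ?_
  · fin_cases i <;> exact Subobject.factors_of_factors_right _ (by assumption)
  · obtain ⟨c, hc, hcS⟩ := H₁.comp prod.fst q b x hx
    obtain ⟨d, hd, hdS⟩ := H₂.comp (prod.snd ≫ prod.fst) q c _ hcS
    obtain ⟨y, hy, z, hz, H⟩ := exists_pair (b := b) (c := d)
      (f := pullback.fst (Asm.under f) (Asm.under g)) (g := pullback.snd _ _) X.isDown Y.isDown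
      (Subobject.factors_of_factors_right (q ≫ prod.snd ≫ prod.snd) hp)
    refine ⟨z, OPAS.mem_eval_app (OPAS.mem_eval_app (P.mem_eval_var _ _)
      (P.mem_eval_var _ _) (c := y) ?_) (OPAS.mem_eval_app (P.mem_eval_var _ _)
        (OPAS.mem_eval_app (P.mem_eval_var _ _) (P.mem_eval_var _ _) hc) hd) hz, ?_⟩
    · rw [Category.assoc] at hy
      exact hy
    · obtain ⟨S, e, y', he, hy', hyR⟩ := imRel_factors.1 hdS
      rw [Category.comp_id] at hy'
      rw [Category.comp_id]
      refine imRel_factors.2 ⟨S, e, pullback.lift (e ≫ x) y'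
        (by rw [hy', Category.assoc]), he, pullback.lift_fst _ _ _, H _ _ ?_ ?_⟩
      · rw [pullback.lift_fst]
        exact lift_factors_comp e hx
      · rwa [pullback.lift_snd]

/-- The monomorphism `m'` does not affect kernel pairs, so a kernel pair of `f` is one of the
regular epimorphism onto the image, which is its coequalizer. -/
instance : Regular (Asm P) where
  hasCoequalizer_of_isKernelPair {X Y Z f g₁ g₂} h := by
    obtain ⟨I, e, m, he, hm, hem⟩ := exists_strongEpi_mono (Asm.under f)
    let m' : imageAsm X e ⟶ Y := Asm.mkHom (X := imageAsm X e) m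
      (RelTracked.of_imRel ((Asm.relTracked f).congr hem.symm))
    have : Mono (Asm.under m') := hm
    have : Mono m' := Asm.mono_of_under m'
    have hf : imageAsmMap X e ≫ m' = f := Asm.hom_ext hem
    have hk : IsKernelPair (imageAsmMap X e) g₁ g₂ :=
      IsKernelPair.cancel_right_of_mono (f₂ := m') (by rwa [hf])
    exact ⟨⟨_, hk.toCoequalizer'⟩⟩
  regularEpiIsStableUnderBaseChange :=
    MorphismProperty.IsStableUnderBaseChange.of_forall_exists_isPullback fun f g _ hg =>
      have : IsRegularEpi g := hg
      ⟨_, _, _, isPullback_pullbackAsm f g, isRegularEpi_pullbackAsmFst f g⟩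

lemma isRegularFunctor_domainFunctor : IsRegularFunctor (domainFunctor P) where
  preservesFiniteLimits := inferInstance
  map_regularEpi f _ :=
    have := strongEpi_under f
    isRegularEpi_of_strongEpi (Asm.under f)

lemma isRegularFunctor_nabla : IsRegularFunctor (nabla P) where
  preservesFiniteLimits :=
    have := (domainNablaAdjunction P).rightAdjoint_preservesLimits
    PreservesLimits.preservesFiniteLimits _
  map_regularEpi {X Y} f _ := by
    refine (isRegularEpi_asm_iff _).2 ⟨inferInstanceAs (StrongEpi f), ?_⟩
    refine relTracked_of_le (imRel_isDown (nablaObj P X).isDown) fun {T} b y _ => ?_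
    obtain ⟨S, e, x, he, hx⟩ := (strongEpi_iff_locally_surjective f).1 inferInstance y
    rw [Category.comp_id]
    exact imRel_factors.2 ⟨S, e, x, he, hx, Subobject.top_factors _⟩

lemma exists_leftAdjoint_asm {X Y : Asm P} (f : X ⟶ Y) : ∃ l : Subobject X → Subobject Y,
    GaloisConnection l (Subobject.pullback f).obj :=
  ⟨_, (Subobject.existsPullbackAdj f).gc⟩

end RegularEpis

/-! ### Tracking as an inequality, and downward closure -/

section Relations

variable {E : Type u} [Category.{v} E] [HeytingCategory E] {P : OPCAPair E}

lemma TracksBy.of_cover {X Y Q : E} {w : Q ⟶ P.carrier} {R : Subobject (P.carrier ⨯ X)}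
    {S : Subobject (P.carrier ⨯ Y)} {f : X ⟶ Y}
    (H : ∀ {T : E} (q : T ⟶ Q) (b : T ⟶ P.carrier) (x : T ⟶ X), R.Factors (prod.lift b x) →
      ∃ (T' : E) (e : T' ⟶ T) (c : T' ⟶ P.carrier), StrongEpi e ∧
        c ∈ P.ap (e ≫ q ≫ w) (e ≫ b) ∧ S.Factors (prod.lift c (e ≫ x ≫ f))) :
    TracksBy w R S f := by
  intro T q b x hx
  obtain ⟨T', e, c, he, hc, hcS⟩ := H q b x hx
  obtain ⟨d, hd, rfl⟩ := P.ap_of_cover e hc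
  exact ⟨d, hd, lift_factors_of_cover e hcS⟩

/-- The largest relation on which `w` tracks `f`. -/
lemma exists_trackRel {X Y Q : E} (w : Q ⟶ P.carrier) (S : Subobject (P.carrier ⨯ Y))
    (f : X ⟶ Y) : ∃ U : Subobject (P.carrier ⨯ X), ∀ R : Subobject (P.carrier ⨯ X),
      TracksBy w R S f ↔ R ≤ U := by
  obtain ⟨V, hV⟩ := P.exists_apSub (G := (P.carrier ⨯ X) ⨯ Q) (prod.snd ≫ w)
    (prod.fst ≫ prod.fst) (prod.fst ≫ prod.snd ≫ f) S
  obtain ⟨U, hU⟩ := exists_forallSub (G := (P.carrier ⨯ X) ⨯ Q) prod.fst V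
  refine ⟨U, fun R => ⟨fun h => le_iff_factors_lift.2 fun {T} b x hx => ?_,
    fun h T q b x hx => ?_⟩⟩
  · refine (hU _).2 fun {T'} s g hg => (hV g).2 ?_
    have e₁ : g ≫ prod.fst ≫ prod.fst = s ≫ b := by rw [← Category.assoc, hg]; simp
    have e₂ : g ≫ prod.fst ≫ prod.snd ≫ f = (s ≫ x) ≫ f := by rw [← Category.assoc, hg]; simp
    rw [e₁, e₂, ← Category.assoc]
    exact h _ _ _ (lift_factors_comp s hx)
  · have := (hV _).1 ((hU _).1 (le_iff_factors_lift.1 h _ _ hx) (𝟙 T)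
      (prod.lift (prod.lift b x) q) (by simp))
    simpa using this

lemma exists_downRel {X : E} (R : Subobject (P.carrier ⨯ X)) :
    ∃ U : Subobject (P.carrier ⨯ X), ∀ {T : E} (a : T ⟶ P.carrier) (x : T ⟶ X),
      U.Factors (prod.lift a x) ↔ ∃ (S : E) (e : S ⟶ T) (d : S ⟶ P.carrier), StrongEpi e ∧
        P.Le (e ≫ a) d ∧ R.Factors (prod.lift d (e ≫ x)) := by
  let m : (P.leq : E) ⟶ P.carrier := P.leq.arrow ≫ prod.snd
  let n : (R : E) ⟶ P.carrier := R.arrow ≫ prod.fst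
  obtain ⟨U, hU⟩ := exists_imageSub (G := pullback m n) (prod.lift
    (pullback.fst m n ≫ P.leq.arrow ≫ prod.fst) (pullback.snd m n ≫ R.arrow ≫ prod.snd))
  refine ⟨U, fun {T} a x => (hU _).trans (exists_congr fun S => exists_congr fun e => ⟨?_, ?_⟩)⟩
  · rintro ⟨g, he, hg⟩
    have h₁ := congrArg (· ≫ prod.fst) hg
    have h₂ := congrArg (· ≫ prod.snd) hg
    simp only [Category.assoc, prod.lift_fst, prod.lift_snd] at h₁ h₂
    have h₃ : g ≫ pullback.fst m n ≫ P.leq.arrow ≫ prod.snd =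
      g ≫ pullback.snd m n ≫ R.arrow ≫ prod.fst := congrArg (g ≫ ·) pullback.condition
    refine ⟨g ≫ pullback.snd m n ≫ R.arrow ≫ prod.fst, he, ?_, ?_⟩
    · unfold OPAS.Le
      rw [← h₁, ← h₃, show prod.lift (g ≫ pullback.fst m n ≫ P.leq.arrow ≫ prod.fst)
        (g ≫ pullback.fst m n ≫ P.leq.arrow ≫ prod.snd) =
          (g ≫ pullback.fst m n) ≫ P.leq.arrow by ext <;> simp]
      exact Subobject.factors_comp_arrow _
    · rw [← h₂, show prod.lift (g ≫ pullback.snd m n ≫ R.arrow ≫ prod.fst)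
        (g ≫ pullback.snd m n ≫ R.arrow ≫ prod.snd) =
          (g ≫ pullback.snd m n) ≫ R.arrow by ext <;> simp]
      exact Subobject.factors_comp_arrow _
  · rintro ⟨d, he, hd, hR⟩
    unfold OPAS.Le at hd
    refine ⟨pullback.lift (P.leq.factorThru _ hd) (R.factorThru _ hR) (by simp [m, n]), he, ?_⟩
    ext <;> simp [pullback.lift_fst_assoc, pullback.lift_snd_assoc]

/-- The downward closure of a relation. -/
def downRel {X : E} (R : Subobject (P.carrier ⨯ X)) : Subobject (P.carrier ⨯ X) :=
  (exists_downRel R).choose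

variable {X Y : E} {R : Subobject (P.carrier ⨯ X)} {S : Subobject (P.carrier ⨯ Y)} {f : X ⟶ Y}

lemma downRel_factors {T : E} {a : T ⟶ P.carrier} {x : T ⟶ X} :
    (downRel R).Factors (prod.lift a x) ↔ ∃ (S : E) (e : S ⟶ T) (d : S ⟶ P.carrier),
      StrongEpi e ∧ P.Le (e ≫ a) d ∧ R.Factors (prod.lift d (e ≫ x)) :=
  (exists_downRel R).choose_spec a x

lemma downRel_isDown (R : Subobject (P.carrier ⨯ X)) : P.IsDown (downRel R) := by
  intro T a b x hx hab
  obtain ⟨S, e, d, he, hd, hR⟩ := downRel_factors.1 hx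
  exact downRel_factors.2 ⟨S, e, d, he, P.le_trans _ _ _ (P.le_comp e hab) hd, hR⟩

lemma le_downRel (R : Subobject (P.carrier ⨯ X)) : R ≤ downRel R :=
  le_iff_factors_lift.2 fun {T} a x hx => downRel_factors.2
    ⟨T, 𝟙 T, a, inferInstance, by simpa using P.le_rfl a, by simpa using hx⟩

/-- By monotonicity `wb ≤ wd` whenever `b ≤ d`, so the same `w` works. -/
lemma TracksBy.of_downRel {Q : E} {w : Q ⟶ P.carrier} (hS : P.IsDown S) (h : TracksBy w R S f) :
    TracksBy w (downRel R) S f := TracksBy.of_cover fun {T} q b x hx => by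
  obtain ⟨T', e, d, he, hd, hR⟩ := downRel_factors.1 hx
  obtain ⟨c, hc, hcS⟩ := h (e ≫ q) d _ hR
  rw [Category.assoc] at hc hcS
  obtain ⟨c', hc', hcc'⟩ := P.ap_mono (P.le_rfl _) hd hc
  exact ⟨T', e, c', he, hc', hS _ _ _ hcS hcc'⟩

end Relations

/-! ### Subobjects of assemblies as relations -/

section Subobjects

variable {E : Type u} [Category.{v} E] [HeytingCategory E] {P : OPCAPair E}

instance {X Y : Asm P} (m : X ⟶ Y) [Mono m] : Mono (Asm.under m) :=
  inferInstanceAs (Mono ((domainFunctor P).map m))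

/-- Elements of `W` have realizers on a cover, and so does the inhabited `Q` have elements; hence
every value of `g` locally has some `R`-realizer. -/
lemma factors_of_relTracked {W : Asm P} {X : E} {R : Subobject (P.carrier ⨯ X)} {g : W.obj ⟶ X}
    (h : RelTracked P W.rel R g) (V : Subobject X) (hV : ∀ {T : E} (c : T ⟶ P.carrier)
      (x : T ⟶ X), R.Factors (prod.lift c x) → V.Factors x) : V.Factors g := by
  obtain ⟨Q, w, hQ, -, H⟩ := h
  obtain ⟨S, e, a, he, ha⟩ := W.exists_rel (𝟙 W.obj)
  rw [Category.comp_id] at ha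
  obtain ⟨c, -, hc⟩ := H (prod.fst : Q ⨯ S ⟶ Q) _ _ (lift_factors_comp prod.snd ha)
  have := strongEpi_snd hQ S
  exact factors_of_cover ((prod.snd : Q ⨯ S ⟶ S) ≫ e) V g (hV _ _ hc)

/-- The realizability relation of a subobject of an assembly. -/
def relOf {X : Asm P} (U : Subobject X) : Subobject (P.carrier ⨯ X.obj) :=
  imRel (Asm.under U.arrow) (U : Asm P).rel

variable {X Y : Asm P}

lemma relOf_isDown (U : Subobject X) : P.IsDown (relOf U) := imRel_isDown (U : Asm P).isDown

lemma relTracked_arrow (U : Subobject X) :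
    RelTracked P (U : Asm P).rel (relOf U) (Asm.under U.arrow) :=
  relTracked_of_le (relOf_isDown U) fun _ _ => imRel_factors_of_factors _

/-- For the converse, realizability by `relOf U` forces `g` through the underlying monomorphism of
`U`. Preimages along it are unique, so the same trackers work for the factorization `k`. -/
lemma factors_iff_relTracked (U : Subobject X) {W : Asm P} (g : W ⟶ X) :
    U.Factors g ↔ RelTracked P W.rel (relOf U) (Asm.under g) := by
  constructor
  · intro h
    refine RelTracked.congr (RelTracked.comp (relOf_isDown U) (Asm.relTracked (U.factorThru g h))
      (relTracked_arrow U)) ?_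
    rw [← Asm.under_comp, Subobject.factorThru_arrow]
  · intro h
    have hg : (Subobject.mk (Asm.under U.arrow)).Factors (Asm.under g) := by
      refine factors_of_relTracked h _ fun c x hx => ?_
      obtain ⟨S, e, y, he, hy, -⟩ := imRel_factors.1 hx
      refine factors_of_cover e _ _ ?_
      rw [← hy]
      exact factors_mk_comp _ _
    obtain ⟨k, hk⟩ : ∃ k, k ≫ Asm.under U.arrow = Asm.under g :=
      ⟨_, ((Subobject.mk_factors_iff _ _).1 hg).choose_spec⟩
    obtain ⟨Q, w, hQ, hw, H⟩ := h
    have hk' : RelTracked P W.rel (U : Asm P).rel k := by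
      refine ⟨Q, w, hQ, hw, fun q b x hx => ?_⟩
      obtain ⟨c, hc, hcU⟩ := H q b x hx
      obtain ⟨S, e, y, he, hy, hyU⟩ := imRel_factors.1 hcU
      refine ⟨c, hc, lift_factors_of_cover e ?_⟩
      rw [← hk, ← Category.assoc, ← Category.assoc, cancel_mono] at hy
      rwa [← Category.assoc, Category.assoc, ← Category.assoc, ← hy]
    have e : g = Asm.mkHom k hk' ≫ U.arrow := Asm.hom_ext hk.symm
    rw [e]
    exact Subobject.factors_comp_arrow _

lemma le_iff_relTracked {U V : Subobject X} :
    U ≤ V ↔ RelTracked P (relOf U) (relOf V) (𝟙 X.obj) := by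
  constructor
  · intro h
    have := (factors_iff_relTracked V U.arrow).1 (Subobject.factors_of_le _ h U.factors_self)
    exact RelTracked.of_imRel (this.congr (Category.comp_id _).symm)
  · intro h
    refine Subobject.le_of_factors ((factors_iff_relTracked V U.arrow).2 ?_)
    exact ((relTracked_arrow U).comp (relOf_isDown V) h).congr (Category.comp_id _)

/-- The carrier is the support of `R`, the image of its projection to `X`, so that every element has
a realizer. -/
lemma exists_subAsm {X : E} (R : Subobject (P.carrier ⨯ X)) (hR : P.IsDown R) :
    ∃ (Z : Asm P) (m : Z.obj ⟶ X), Mono m ∧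
      (∀ {T : E} (a : T ⟶ P.carrier) (z : T ⟶ Z.obj), Z.rel.Factors (prod.lift a z) ↔
        R.Factors (prod.lift a (z ≫ m))) ∧
      ∀ {T : E} (a : T ⟶ P.carrier) (x : T ⟶ X), R.Factors (prod.lift a x) →
        ∃ z : T ⟶ Z.obj, z ≫ m = x := by
  obtain ⟨I, e, m, he, hm, hem⟩ := exists_strongEpi_mono (R.arrow ≫ prod.snd)
  let S : Subobject (P.carrier ⨯ I) :=
    (Subobject.pullback (prod.lift prod.fst (prod.snd ≫ m))).obj R
  have hS : ∀ {T : E} (a : T ⟶ P.carrier) (z : T ⟶ I), S.Factors (prod.lift a z) ↔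
      R.Factors (prod.lift a (z ≫ m)) := fun a z => by
    rw [pullback_factors_iff, prod.comp_lift]
    simp
  refine ⟨⟨I, S, ?_, fun a b x hx hab => (hS _ _).2 (hR _ _ _ ((hS _ _).1 hx) hab)⟩, m, hm, hS,
    fun a x hx => ⟨R.factorThru _ hx ≫ e, by simp [hem]⟩⟩
  rw [isRegularEpi_proj_iff]
  intro T x
  obtain ⟨T', s, g, hs, hg⟩ := (strongEpi_iff_locally_surjective e).1 he x
  refine ⟨T', s, g ≫ R.arrow ≫ prod.fst, hs, ?_⟩
  rw [hS, ← hg, Category.assoc, hem, show prod.lift (g ≫ R.arrow ≫ prod.fst)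
    (g ≫ R.arrow ≫ prod.snd) = g ≫ R.arrow by ext <;> simp]
  exact Subobject.factors_comp_arrow _

/-- Downward closed relations that refine the relation of `X` determine subobjects of `X`. -/
lemma exists_subobject (R : Subobject (P.carrier ⨯ X.obj)) (hR : P.IsDown R)
    (h : RelTracked P R X.rel (𝟙 X.obj)) : ∃ U : Subobject X,
      RelTracked P (relOf U) R (𝟙 X.obj) ∧ RelTracked P R (relOf U) (𝟙 X.obj) := by
  obtain ⟨Z, m, hm, hZ, hZ'⟩ := exists_subAsm R hR
  have hmR : RelTracked P Z.rel R m := relTracked_of_le hR fun _ _ => (hZ _ _).1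
  let m' : Z ⟶ X := Asm.mkHom m ((hmR.comp X.isDown h).congr (Category.comp_id _))
  have : Mono (Asm.under m') := hm
  have : Mono m' := Asm.mono_of_under m'
  refine ⟨Subobject.mk m', RelTracked.of_imRel ?_, ?_⟩
  · refine ((Asm.relTracked (Subobject.underlyingIso m').hom).comp hR hmR).congr ?_
    rw [Category.comp_id]
    exact congrArg Asm.under (Subobject.underlyingIso_hom_comp_eq_mk m')
  · have h₁ : RelTracked P R (imRel m Z.rel) (𝟙 X.obj) :=
      relTracked_of_le (imRel_isDown Z.isDown) fun a x hx => by
        obtain ⟨z, rfl⟩ := hZ' a x hx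
        rw [Category.comp_id]
        exact imRel_factors_of_factors m ((hZ a z).2 hx)
    have h₂ : RelTracked P Z.rel (relOf (Subobject.mk m')) m :=
      (factors_iff_relTracked _ m').1 (Subobject.mk_factors_self m')
    exact (h₁.comp (relOf_isDown _)
      (RelTracked.of_imRel (h₂.congr (Category.comp_id m).symm))).congr (Category.comp_id _)

/-! ### Bottom and joins -/

lemma exists_bot_asm (X : Asm P) : ∃ B : Subobject X, ∀ U : Subobject X, B ≤ U := by
  obtain ⟨O, hO⟩ := HeytingCategory.exists_bot (P.carrier ⨯ X.obj)
  have key : ∀ S : Subobject (P.carrier ⨯ X.obj), P.IsDown S →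
      RelTracked P (downRel O) S (𝟙 X.obj) := fun S hS => by
    -- Any element of `A'` would do as `w`: tracking on `O` is an inequality `O ≤ U`.
    obtain ⟨Q, w, hQ, hw, -⟩ := P.exists_id
    obtain ⟨U, hU⟩ := exists_trackRel w S (𝟙 X.obj)
    exact ⟨Q, w, hQ, hw, TracksBy.of_downRel hS ((hU O).2 (hO U))⟩
  obtain ⟨B, hB, -⟩ := exists_subobject (downRel O) (downRel_isDown O) (key _ X.isDown)
  exact ⟨B, fun U => le_iff_relTracked.2 ((hB.comp (relOf_isDown U)
    (key _ (relOf_isDown U))).congr (Category.comp_id _))⟩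

variable (P) in
/-- The realizers of the injections `b ↦ (u, v) ↦ u b` and `b ↦ (u, v) ↦ v b` into a sum. -/
abbrev injRealizers (j : Fin 3) : Subobject P.carrier :=
  P.realizers (.app (.var j) (.var 0))

/-- The direct image of a relation under an injection into a sum. -/
lemma exists_injRel (j : Fin 3) {X : E} (R : Subobject (P.carrier ⨯ X)) :
    ∃ U : Subobject (P.carrier ⨯ X),
      (∀ {T : E} (i b : T ⟶ P.carrier) (x : T ⟶ X), (injRealizers P j).Factors i →
        R.Factors (prod.lift b x) → ∃ d ∈ P.ap i b, U.Factors (prod.lift d x)) ∧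
      ∀ {T : E} (a : T ⟶ P.carrier) (x : T ⟶ X), U.Factors (prod.lift a x) →
        ∃ (S : E) (e : S ⟶ T) (i b : S ⟶ P.carrier), StrongEpi e ∧
          (injRealizers P j).Factors i ∧ e ≫ a ∈ P.ap i b ∧ R.Factors (prod.lift b (e ≫ x)) := by
  let G := (injRealizers P j : E) ⨯ (R : E)
  let k : G ⟶ P.carrier := prod.fst ≫ (injRealizers P j).arrow
  have hk : (injRealizers P j).Factors k := Subobject.factors_comp_arrow _
  -- Only `d = ib` is used; the second argument is a dummy.
  obtain ⟨d, hd, -⟩ := P.exists_of_realizer_three hk (prod.snd ≫ R.arrow ≫ prod.fst)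
    (prod.snd ≫ R.arrow ≫ prod.fst)
  obtain ⟨U, hU⟩ := exists_imageSub (G := G) (prod.lift d (prod.snd ≫ R.arrow ≫ prod.snd))
  refine ⟨U, fun {T} i b x hi hb => ?_, fun {T} a x hx => ?_⟩
  · let g : T ⟶ G := prod.lift ((injRealizers P j).factorThru i hi) (R.factorThru _ hb)
    refine ⟨g ≫ d, ?_, (hU _).2 ⟨T, 𝟙 T, g, inferInstance, by ext <;> simp [g]⟩⟩
    simpa [g, k] using P.ap_comp g hd
  · obtain ⟨S, e, g, he, hg⟩ := (hU _).1 hx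
    have h₁ := congrArg (· ≫ prod.fst) hg
    have h₂ := congrArg (· ≫ prod.snd) hg
    simp only [Category.assoc, prod.lift_fst, prod.lift_snd] at h₁ h₂
    refine ⟨S, e, g ≫ k, g ≫ prod.snd ≫ R.arrow ≫ prod.fst, he,
      Subobject.factors_of_factors_right g hk, h₁ ▸ P.ap_comp g hd, ?_⟩
    rw [← h₂, show prod.lift (g ≫ prod.snd ≫ R.arrow ≫ prod.fst)
      (g ≫ prod.snd ≫ R.arrow ≫ prod.snd) = (g ≫ prod.snd) ≫ R.arrow by ext <;> simp]
    exact Subobject.factors_comp_arrow _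

/-- Disjunction of realizability relations. -/
lemma exists_disjRel {X : E} (R₁ R₂ : Subobject (P.carrier ⨯ X)) :
    ∃ W : Subobject (P.carrier ⨯ X), P.IsDown W ∧ RelTracked P R₁ W (𝟙 X) ∧
      RelTracked P R₂ W (𝟙 X) ∧ ∀ S : Subobject (P.carrier ⨯ X), P.IsDown S →
        RelTracked P R₁ S (𝟙 X) → RelTracked P R₂ S (𝟙 X) → RelTracked P W S (𝟙 X) := by
  obtain ⟨D₁, h₁, h₁'⟩ := exists_injRel 1 R₁
  obtain ⟨D₂, h₂, h₂'⟩ := exists_injRel 2 R₂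
  obtain ⟨D, hD⟩ := HeytingCategory.exists_sup D₁ D₂
  have hD₁ : D₁ ≤ D := hD.1 (by simp)
  have hD₂ : D₂ ≤ D := hD.1 (by simp)
  have inj : ∀ (j : Fin 3) (R D' : Subobject (P.carrier ⨯ X)), D' ≤ D →
      (∀ {T : E} (i b : T ⟶ P.carrier) (x : T ⟶ X), (injRealizers P j).Factors i →
        R.Factors (prod.lift b x) → ∃ d ∈ P.ap i b, D'.Factors (prod.lift d x)) →
      RelTracked P R (downRel D) (𝟙 X) := fun j R D' hD' h => by
    obtain ⟨Q, i, hQ, hi, hi'⟩ := (P.intersects_realizers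
      (.app (.var j) (.var 0) : CombTerm 3)).exists_element
    refine ⟨Q, i, hQ, hi', fun q b x hx => ?_⟩
    obtain ⟨d, hd, hdD⟩ := h (q ≫ i) b x (Subobject.factors_of_factors_right q hi) hx
    exact ⟨d, hd, by simpa using Subobject.factors_of_le _ (hD'.trans (le_downRel D)) hdD⟩
  refine ⟨downRel D, downRel_isDown D, inj 1 _ _ hD₁ h₁, inj 2 _ _ hD₂ h₂, fun S hS H₁ H₂ => ?_⟩
  obtain ⟨Q₁, u, hQ₁, hu, H₁⟩ := H₁
  obtain ⟨Q₂, v, hQ₂, hv, H₂⟩ := H₂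
  -- `r` realizes the case distinction `a ↦ auv`: on a tagged `b` this lies below `ub` or `vb`,
  -- according to the tag.
  obtain ⟨Q, p, r, hQ, hr, H⟩ := P.exists_partial_realizer (m := 0)
    (.app (.app (.var (2 : Fin 3)) (.var 0)) (.var 1)) (inhabited_prod hQ₁ hQ₂)
    ![prod.fst ≫ u, prod.snd ≫ v] (fun i => by
      fin_cases i
      exacts [Subobject.factors_of_factors_right _ hu, Subobject.factors_of_factors_right _ hv])
  obtain ⟨V, hV⟩ := exists_trackRel r S (𝟙 X)
  have elim : ∀ (j : Fin 3) (R D' : Subobject (P.carrier ⨯ X)),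
      (∀ {T : E} (a : T ⟶ P.carrier) (x : T ⟶ X), D'.Factors (prod.lift a x) →
        ∃ (T' : E) (e : T' ⟶ T) (i b : T' ⟶ P.carrier), StrongEpi e ∧
          (injRealizers P j).Factors i ∧ e ≫ a ∈ P.ap i b ∧
            R.Factors (prod.lift b (e ≫ x))) →
      (∀ {T : E} (q : T ⟶ Q₁ ⨯ Q₂) (b : T ⟶ P.carrier) (x : T ⟶ X), R.Factors (prod.lift b x) →
        ∃ c ∈ P.eval ![b, q ≫ prod.fst ≫ u, q ≫ prod.snd ≫ v] (.app (.var j) (.var 0)),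
          S.Factors (prod.lift c x)) → TracksBy r D' S (𝟙 X) := fun j R D' hD' hR => by
    refine TracksBy.of_cover fun {T} q a x hx => ?_
    obtain ⟨T', e, i, b, he, hi, hib, hb⟩ := hD' a x hx
    obtain ⟨c, hc, hcS⟩ := hR ((e ≫ q) ≫ p) b _ hb
    obtain ⟨d₁, hd₁, d₂, hd₂, hd⟩ :=
      P.exists_of_realizer_three hi b (((e ≫ q) ≫ p) ≫ prod.fst ≫ u)
    obtain rfl := Part.mem_unique hib hd₁
    obtain ⟨z, hz, hzc⟩ := hd (𝟙 T') (((e ≫ q) ≫ p) ≫ prod.snd ≫ v) c (by simpa using hc)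
    rw [Category.id_comp] at hz
    obtain ⟨y, hy, hyz⟩ := (H (e ≫ q) ![e ≫ a]).2 z (OPAS.mem_eval_app (OPAS.mem_eval_app
      (P.mem_eval_var _ _) (P.mem_eval_var _ _) hd₂)
      (P.mem_eval_var _ _) hz)
    refine ⟨T', e, y, he, by simpa [OPAS.apList] using hy, ?_⟩
    rw [Category.comp_id]
    exact hS _ _ _ (hS _ _ _ hcS hzc) hyz
  -- Tracking by `r` means lying below `V`, so it passes from `D₁` and `D₂` to their join.
  refine ⟨Q, r, hQ, hr, TracksBy.of_downRel hS ((hV D).2 (hD.2 ?_))⟩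
  rintro D' (rfl | rfl)
  · refine (hV _).1 (elim 1 R₁ _ h₁' fun q b x hx => ?_)
    obtain ⟨c, hc, hcS⟩ := H₁.comp prod.fst q b x hx
    exact ⟨c, OPAS.mem_eval_app (P.mem_eval_var _ _) (P.mem_eval_var _ _) hc, by simpa using hcS⟩
  · refine (hV _).1 (elim 2 R₂ _ h₂' fun q b x hx => ?_)
    obtain ⟨c, hc, hcS⟩ := H₂.comp prod.snd q b x hx
    exact ⟨c, OPAS.mem_eval_app (P.mem_eval_var _ _) (P.mem_eval_var _ _) hc, by simpa using hcS⟩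

lemma RelTracked.trans {X : E} {R S T : Subobject (P.carrier ⨯ X)} (hT : P.IsDown T)
    (h₁ : RelTracked P R S (𝟙 X)) (h₂ : RelTracked P S T (𝟙 X)) : RelTracked P R T (𝟙 X) :=
  (h₁.comp hT h₂).congr (Category.comp_id _)

lemma relTracked_relOf (U : Subobject X) : RelTracked P (relOf U) X.rel (𝟙 X.obj) :=
  RelTracked.of_imRel ((Asm.relTracked U.arrow).congr (Category.comp_id _).symm)

lemma exists_sup_asm (U V : Subobject X) : ∃ W : Subobject X, IsLUB {U, V} W := by
  obtain ⟨D, hD, hUD, hVD, H⟩ := exists_disjRel (relOf U) (relOf V)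
  obtain ⟨W, hW, hW'⟩ := exists_subobject D hD
    (H _ X.isDown (relTracked_relOf U) (relTracked_relOf V))
  refine ⟨W, ?_, fun T hT => le_iff_relTracked.2 (hW.trans (relOf_isDown T)
    (H _ (relOf_isDown T) (le_iff_relTracked.1 (hT (by simp)))
      (le_iff_relTracked.1 (hT (by simp)))))⟩
  rintro T (rfl | rfl)
  · exact le_iff_relTracked.2 (hUD.trans (relOf_isDown W) hW')
  · exact le_iff_relTracked.2 (hVD.trans (relOf_isDown W) hW')

/-! ### Right adjoints and implication -/

/-- Universal quantification of realizability relations. -/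
lemma exists_forallRel (f : X ⟶ Y) (S : Subobject (P.carrier ⨯ X.obj)) :
    ∃ R : Subobject (P.carrier ⨯ Y.obj), ∀ {T : E} (a : T ⟶ P.carrier) (y : T ⟶ Y.obj),
      R.Factors (prod.lift a y) ↔ ∀ {T' : E} (s : T' ⟶ T) (b : T' ⟶ P.carrier)
        (x : T' ⟶ X.obj), x ≫ Asm.under f = s ≫ y → X.rel.Factors (prod.lift b x) →
          ∃ c ∈ P.ap (s ≫ a) b, S.Factors (prod.lift c x) := by
  let G := P.carrier ⨯ (X.rel : E)
  obtain ⟨V, hV⟩ := P.exists_apSub (G := G) prod.fst (prod.snd ≫ X.rel.arrow ≫ prod.fst)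
    (prod.snd ≫ X.rel.arrow ≫ prod.snd) S
  obtain ⟨R, hR⟩ := exists_forallSub (G := G)
    (prod.lift prod.fst (prod.snd ≫ X.rel.arrow ≫ prod.snd ≫ Asm.under f)) V
  refine ⟨R, fun {T} a y => (hR _).trans ⟨fun h T' s b x hx hb => ?_, fun h T' s g hg => ?_⟩⟩
  · have := (hV _).1 (h s (prod.lift (s ≫ a) (X.rel.factorThru _ hb)) (by ext <;> simp [hx]))
    simpa using this
  · have h₁ := congrArg (· ≫ prod.fst) hg
    have h₂ := congrArg (· ≫ prod.snd) hg
    simp only [Category.assoc, prod.lift_fst, prod.lift_snd] at h₁ h₂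
    obtain ⟨c, hc, hcS⟩ := h s (g ≫ prod.snd ≫ X.rel.arrow ≫ prod.fst)
      (g ≫ prod.snd ≫ X.rel.arrow ≫ prod.snd) (by simpa using h₂) (by
        rw [show prod.lift (g ≫ prod.snd ≫ X.rel.arrow ≫ prod.fst)
          (g ≫ prod.snd ≫ X.rel.arrow ≫ prod.snd) = (g ≫ prod.snd) ≫ X.rel.arrow by ext <;> simp]
        exact Subobject.factors_comp_arrow _)
    exact (hV g).2 ⟨c, h₁ ▸ hc, hcS⟩

/-- The clause `R U` says nothing about how `y` itself is realized, so it is paired with the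
relation of `Y` to obtain a subobject of `Y`. -/
lemma exists_rightAdjoint_asm (f : X ⟶ Y) : ∃ r : Subobject X → Subobject Y,
    GaloisConnection (Subobject.pullback f).obj r := by
  choose R hR using fun U : Subobject X => exists_forallRel f (relOf U)
  have hRd : ∀ U, P.IsDown (R U) := fun U T a b y hy hab => (hR U _ _).2 fun s k x hx hk => by
    obtain ⟨c, hc, hcU⟩ := (hR U _ _).1 hy s k x hx hk
    obtain ⟨d, hd, hdc⟩ := P.ap_mono (P.le_comp s hab) (P.le_rfl k) hc
    exact ⟨d, hd, relOf_isDown U _ _ _ hcU hdc⟩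
  let C (U : Subobject X) : Subobject (P.carrier ⨯ Y.obj) :=
    conjRel P (𝟙 Y.obj) (R U) (𝟙 Y.obj) Y.rel
  choose r hr hr' using fun U : Subobject X => exists_subobject (C U)
    (conjRel_isDown (hRd U) Y.isDown) (relTracked_conjRel_snd Y.isDown)
  refine ⟨r, fun T U => ⟨fun h => ?_, fun h => ?_⟩⟩
  · refine le_iff_relTracked.2 (RelTracked.trans (relOf_isDown _)
      (relTracked_conjRel (hRd U) Y.isDown ?_ ?_) (hr' U))
    · rw [Category.comp_id]
      -- `g` represents the inverse image of `T` with explicit pair codes as realizers, so a tracker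
      -- `u` of its inclusion in `U` can be fed with pairs.
      let g := pullbackAsmFst f T.arrow
      have hg : U.Factors g := by
        refine Subobject.factors_of_le _ h ((pullback_factors_iff _ _ _).2 ?_)
        rw [(isPullback_pullbackAsm f T.arrow).w]
        exact Subobject.factors_comp_arrow _
      obtain ⟨Q₁, u, hQ₁, hu, H₁⟩ := (factors_iff_relTracked U g).1 hg
      obtain ⟨Q₂, p, hQ₂, hp, hp'⟩ := exists_pairRealizer P
      -- The term is `(a, b) ↦ u(pba)`, with `a` realizing an element of `T` and `b` an element of
      -- `X` over it.
      obtain ⟨Q, π, w, hQ, hw, H⟩ := exists_of_term_two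
        (.app (.var (0 : Fin 4)) (.app (.app (.var 1) (.var 3)) (.var 2)))
        (inhabited_prod hQ₁ hQ₂) ![prod.fst ≫ u, prod.snd ≫ p] (fun i => by
          fin_cases i <;> exact Subobject.factors_of_factors_right _ (by assumption))
      refine RelTracked.of_imRel (RelTracked.congr (f := Asm.under T.arrow)
        ⟨Q, w, hQ, hw, fun {S} q a t ht => ?_⟩ (Category.comp_id _).symm)
      obtain ⟨d, hd, H⟩ := H q a
      refine ⟨d, hd, (hR U _ _).2 fun {S'} s b x hx hb => ?_⟩
      obtain ⟨y, hy, z, hz, Hz⟩ := exists_pair (b := b) (c := s ≫ a)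
        (f := pullback.fst (Asm.under f) (Asm.under T.arrow)) (g := pullback.snd _ _)
        X.isDown (T : Asm P).isDown
        (Subobject.factors_of_factors_right ((s ≫ q ≫ π) ≫ prod.snd) hp)
      have hx' : x ≫ Asm.under f = (s ≫ t) ≫ Asm.under T.arrow := by
        rw [hx, Category.assoc]
      obtain ⟨k, hk, hk'⟩ : ∃ k : S' ⟶ (pullbackAsm f T.arrow).obj, k ≫ Asm.under g = x ∧
          k ≫ Asm.under (pullbackAsmSnd f T.arrow) = s ≫ t :=
        ⟨pullback.lift x (s ≫ t) hx', pullback.lift_fst _ _ _, pullback.lift_snd _ _ _⟩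
      have hz' := Hz (𝟙 S') k (by rw [Category.id_comp]; exact hk.symm ▸ hb)
        (by rw [Category.id_comp]; exact hk'.symm ▸ lift_factors_comp s ht)
      rw [Category.id_comp] at hz'
      obtain ⟨c, hc, hcU⟩ := H₁.comp prod.fst (s ≫ q ≫ π) z k hz'
      rw [hk] at hcU
      rw [Category.assoc] at hy
      obtain ⟨z', hzb, hzc⟩ := H s b c (OPAS.mem_eval_app (P.mem_eval_var _ _)
        (OPAS.mem_eval_app (OPAS.mem_eval_app (P.mem_eval_var _ _) (P.mem_eval_var _ _) hy)
          (P.mem_eval_var _ _) hz) hc)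
      exact ⟨z', hzb, relOf_isDown U _ _ _ hcU hzc⟩
    · rw [Category.comp_id]
      exact relTracked_relOf T
  · refine Subobject.le_of_factors ((factors_iff_relTracked U _).2 ?_)
    let V := (Subobject.pullback f).obj T
    let g : (V : Asm P) ⟶ (T : Asm P) := Subobject.pullbackπ f T
    have hg : Asm.under g ≫ Asm.under T.arrow = Asm.under V.arrow ≫ Asm.under f :=
      congrArg Asm.under (Subobject.isPullback f T).w
    obtain ⟨Q₁, u, hQ₁, hu, H₁⟩ := Asm.relTracked V.arrow
    have h' : RelTracked P (V : Asm P).rel (R U) (Asm.under g ≫ Asm.under T.arrow) :=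
      (Asm.relTracked g).comp (hRd U) (((relTracked_arrow T).comp (hRd U)
        (((le_iff_relTracked.1 h).trans (conjRel_isDown (hRd U) Y.isDown) (hr U)).trans (hRd U)
          (relTracked_conjRel_fst (hRd U)))).congr (Category.comp_id _))
    rw [hg] at h'
    obtain ⟨Q₂, v, hQ₂, hv, H₂⟩ := h'
    -- The term is `a ↦ (va)(ua)`: `va` realizes the universal statement and `ua` the element of `X`
    -- at which it is used.
    refine relTracked_of_term (.app (.app (.var (1 : Fin 3)) (.var 2)) (.app (.var 0) (.var 2)))
      (relOf_isDown U) (inhabited_prod hQ₁ hQ₂) ![prod.fst ≫ u, prod.snd ≫ v] (fun i => ?_)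
      fun {S} q a x hx => ?_
    · fin_cases i <;> exact Subobject.factors_of_factors_right _ (by assumption)
    · obtain ⟨b, hb, hbX⟩ := H₁.comp prod.fst q a x hx
      obtain ⟨d, hd, hdR⟩ := H₂.comp prod.snd q a x hx
      obtain ⟨c, hc, hcU⟩ := (hR U _ _).1 hdR (𝟙 S) b (x ≫ Asm.under V.arrow) (by simp) hbX
      rw [Category.id_comp] at hc
      exact ⟨c, OPAS.mem_eval_app (OPAS.mem_eval_app (P.mem_eval_var _ _) (P.mem_eval_var _ _) hd)
        (OPAS.mem_eval_app (P.mem_eval_var _ _) (P.mem_eval_var _ _) hb) hc, hcU⟩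

/-- Implication is universal quantification along a monomorphism. -/
lemma exists_himp_asm (U V : Subobject X) : ∃ W : Subobject X,
    ∀ T : Subobject X, T ≤ W ↔ T ⊓ U ≤ V := by
  obtain ⟨r, hr⟩ := exists_rightAdjoint_asm U.arrow
  refine ⟨r ((Subobject.pullback U.arrow).obj V), fun T => ?_⟩
  rw [← hr]
  constructor
  · refine fun h => le_iff_factors.2 fun {W} x hx => ?_
    obtain ⟨hT, hU⟩ := (Subobject.inf_factors _).1 hx
    have h' := le_iff_factors.1 h (U.factorThru x hU)
    rw [pullback_factors_iff, pullback_factors_iff, Subobject.factorThru_arrow] at h'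
    exact h' hT
  · refine fun h => le_iff_factors.2 fun {W} x hx => ?_
    rw [pullback_factors_iff] at hx ⊢
    exact Subobject.factors_of_le _ h
      ((Subobject.inf_factors _).2 ⟨hx, Subobject.factors_comp_arrow x⟩)

end Subobjects

end RelRealizability

end

theorem mainTheorem2 {E : Type u} [Category.{v} E] [HeytingCategory E] (P : OPCAPair E) :
    HeytingCategory (Asm P) ∧
    IsRegularFunctor (domainFunctor P) ∧
    (domainFunctor P).Faithful ∧
    IsRegularFunctor (nabla P) ∧
    Nonempty (domainFunctor P ⊣ nabla P) :=
  ⟨{ exists_bot := exists_bot_asm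
     exists_sup := exists_sup_asm
     exists_himp := exists_himp_asm
     exists_leftAdjoint := exists_leftAdjoint_asm
     exists_rightAdjoint := exists_rightAdjoint_asm },
    isRegularFunctor_domainFunctor, inferInstance, isRegularFunctor_nabla,
    ⟨domainNablaAdjunction P⟩⟩
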